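/- Let $n\ge 1$ and $0\le j\le n$. A convex body in $\mathbb R^n$ is a compact convex set with nonempty interior. Let $\omega_k$ be the volume of the unit ball of $\mathbb R^k$, let $G_{n,j}$ be the Grassmannian of $j$-dimensional linear subspaces of $\mathbb R^n$ with its rotation-invariant (Haar) probability measure $\mu_j$, and for $\xi\in G_{n,j}$ let $K|\xi$ be the orthogonal projection of $K$ onto $\xi$. For convex bodies $K_1,\dots,K_j$ in $\mathbb R^n$ define the mixed affine quermassintegral $$\Phi_{n-j}(K_1,\dots,K_j)=\omega_n\left[\int_{G_{n,j}}\left(\frac{V_\xi(K_1|\xi,\dots,K_j|\xi)}{\omega_j}\right)^{-n}d\mu_j(\xi)\right]^{-1/n},$$ where $V_\xi(A_1,\dots,A_j)=\frac1{j!}\sum_{S\subseteq\{1,\dots,j\}}(-1)^{j-|S|}\,\mathrm{vol}_j\big(\sum_{i\in S}A_i\big)$ is the $j$-dimensional mixed volume in $\xi$. Write $$\Phi_{n-j}(K)=\omega_n\left[\int_{G_{n,j}}\left(\frac{\mathrm{vol}_j(K|\xi)}{\omega_j}\right)^{-n}d\mu_j(\xi)\right]^{-1/n}$$ for the affine quermassintegral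 of $K$ (the case $K_1=\dots=K_j=K$), and $\Phi_{n-j}(K,L)=\Phi_{n-j}(K,\dots,K,L)$ with $j-1$ copies of $K$ and one copy of $L$ (for $j=0$ the tuple is empty, and $\Phi_n=\omega_n$). If $K$ and $L$ are convex bodies in $\mathbb R^n$ containing the origin, then $$\Phi_{n-j}(K,L)^{j}\ \ge\ \Phi_{n-j}(K)^{j-1}\,\Phi_{n-j}(L).$$ If moreover $j\ge 2$, then equality holds if and only if $K$ and $L$ are homothetic, that is, $K=cL+t$ for some $c>0$ and $t\in\mathbb R^n$. -/

import Mathlib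

open MeasureTheory
open scoped Pointwise

noncomputable section

namespace MixedAffine

/-- Euclidean `n`-space. -/
abbrev E (n : ℕ) : Type := EuclideanSpace ℝ (Fin n)

/-- The volume `ω_k` of the unit ball of Euclidean `k`-space. -/
def omega (k : ℕ) : ℝ := volume.real (Metric.closedBall (0 : E k) 1)

/-- The mixed volume of `j` compact convex sets in a Euclidean space `F` (of dimension `j`):
`V(K₁, …, K_j) = (1 / j!) ∑_{S ⊆ {1, …, j}} (-1)^{j - |S|} vol (∑_{i ∈ S} K_i)`,
the sums of sets being Minkowski sums (the empty one is `{0}`). -/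
def mixedVolume {F : Type*} [NormedAddCommGroup F] [InnerProductSpace ℝ F]
    [FiniteDimensional ℝ F] [MeasurableSpace F] [BorelSpace F]
    {j : ℕ} (K : Fin j → ConvexBody F) : ℝ :=
  ((j.factorial : ℝ))⁻¹ * ∑ S : Finset (Fin j),
    (-1 : ℝ) ^ (j - S.card) * volume.real ((∑ i ∈ S, K i : ConvexBody F) : Set F)

/-- The orthogonal projection `K | ξ`, as a convex body of the Euclidean space `ξ`. -/
def proj {n : ℕ} (K : ConvexBody (E n)) (ξ : Submodule ℝ (E n)) : ConvexBody ξ where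
  carrier := ξ.orthogonalProjectionOnto '' (K : Set (E n))
  convex' := K.convex.linear_image ξ.orthogonalProjectionOnto.toLinearMap
  isCompact' := K.isCompact.image ξ.orthogonalProjectionOnto.continuous
  nonempty' := K.nonempty.image _

/-- The Grassmannian `G_{n,j}` of `j`-dimensional linear subspaces of Euclidean `n`-space. -/
structure Gr (n j : ℕ) where
  /-- the underlying subspace -/
  space : Submodule ℝ (E n)
  finrank_eq : Module.finrank ℝ space = j

/-- The usual topology of the Grassmannian, given by the distance `‖P_ξ - P_η‖` of the orthogonal
projections. -/
instance (n j : ℕ) : TopologicalSpace (Gr n j) :=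
  TopologicalSpace.induced (fun ξ : Gr n j => ξ.space.starProjection) inferInstance

instance (n j : ℕ) : MeasurableSpace (Gr n j) := borel _

instance (n j : ℕ) : BorelSpace (Gr n j) := ⟨rfl⟩

/-- The orthogonal group `O(n)`, with the topology of the operator norm. -/
abbrev O (n : ℕ) : Type := unitary (E n →L[ℝ] E n)

instance (n : ℕ) : ContinuousStar (E n →L[ℝ] E n) :=
  ⟨(ContinuousLinearMap.adjoint (𝕜 := ℝ) (E := E n) (F := E n)).continuous⟩

instance (n : ℕ) : CompactSpace (O n) := by
  apply isCompact_iff_compactSpace.mp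
  refine Metric.isCompact_of_isClosed_isBounded isClosed_unitary ?_
  refine (Metric.isBounded_closedBall (x := 0) (r := 1)).subset fun g hg => ?_
  rw [mem_closedBall_zero_iff]
  refine ContinuousLinearMap.opNorm_le_bound _ zero_le_one fun x => ?_
  rw [one_mul]
  exact ((Unitary.linearIsometryEquiv ⟨g, hg⟩).norm_map x).le

/-- The Haar probability measure of `O(n)`. -/
def haarO (n : ℕ) : Measure (O n) := Measure.haarMeasure ⊤

instance (n : ℕ) : IsProbabilityMeasure (haarO n) :=
  ⟨by simpa [haarO] using Measure.haarMeasure_self (K₀ := (⊤ : TopologicalSpace.PositiveCompacts (O n)))⟩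

/-- The image `g ξ` of a subspace under an orthogonal transformation. -/
def rotate {n j : ℕ} (g : O n) (ξ : Gr n j) : Gr n j :=
  ⟨ξ.space.map ((Unitary.linearIsometryEquiv g).toLinearEquiv : E n →ₗ[ℝ] E n), by
    rw [LinearEquiv.finrank_map_eq]; exact ξ.finrank_eq⟩

/-- The coordinate subspace spanned by the first `j` vectors of the standard basis. -/
def coordSubspace {n j : ℕ} (hj : j ≤ n) : Gr n j :=
  ⟨Submodule.span ℝ (Set.range fun i : Fin j => EuclideanSpace.single (Fin.castLE hj i) (1 : ℝ)), by
    have h : LinearIndependent ℝ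
        fun i : Fin j => EuclideanSpace.single (Fin.castLE hj i) (1 : ℝ) :=
      (EuclideanSpace.orthonormal_single (𝕜 := ℝ) (ι := Fin n)).linearIndependent.comp
        (Fin.castLE hj) (Fin.castLE_injective hj)
    exact (finrank_span_eq_card h).trans (Fintype.card_fin j)⟩

lemma continuous_rotate {n j : ℕ} (ξ : Gr n j) : Continuous fun g : O n => rotate g ξ := by
  rw [continuous_induced_rng]
  have h : ((fun ξ : Gr n j => ξ.space.starProjection) ∘ fun g : O n => rotate g ξ) =
      fun g : O n => (g : E n →L[ℝ] E n) * ξ.space.starProjection * ((g⁻¹ : O n) : E n →L[ℝ] E n) := by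
    funext g
    ext1 x
    exact Submodule.starProjection_map_apply (Unitary.linearIsometryEquiv g) ξ.space x
  rw [h]
  exact (continuous_subtype_val.mul continuous_const).mul
    (continuous_subtype_val.comp continuous_inv)

/-- The normalized Haar measure `μ_j` on the Grassmannian, i.e. the distribution of `g ξ₀` for a
`j`-dimensional subspace `ξ₀` and a Haar-distributed `g ∈ O(n)`. -/
def grMeasure {n j : ℕ} (hj : j ≤ n) : Measure (Gr n j) :=
  (haarO n).map fun g => rotate g (coordSubspace hj)

instance {n j : ℕ} (hj : j ≤ n) : IsProbabilityMeasure (grMeasure hj) :=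
  Measure.isProbabilityMeasure_map (continuous_rotate _).measurable.aemeasurable

/-- The mixed affine quermassintegral `Φ_{n-j}(K₁, …, K_j)`. -/
def mixedPhi {n j : ℕ} (hj : j ≤ n) (K : Fin j → ConvexBody (E n)) : ℝ :=
  omega n * (∫ ξ : Gr n j, (mixedVolume (fun i => proj (K i) ξ.space) / omega j) ^ (-(n : ℝ))
    ∂(grMeasure hj)) ^ (-1 / (n : ℝ))

/-- Lutwak's affine quermassintegral `Φ_{n-j}(K)`, defined by the volumes of projections. -/
def Phi {n j : ℕ} (hj : j ≤ n) (K : ConvexBody (E n)) : ℝ :=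
  omega n * (∫ ξ : Gr n j, (volume.real (proj K ξ.space : Set ξ.space) / omega j) ^ (-(n : ℝ))
    ∂(grMeasure hj)) ^ (-1 / (n : ℝ))

/-- `Φ_{n-j}(K, L) = Φ_{n-j}(K, …, K, L)` with `j - 1` copies of `K` followed by one of `L`. -/
def Phi₁ {n j : ℕ} (hj : j ≤ n) (K L : ConvexBody (E n)) : ℝ :=
  mixedPhi hj fun i : Fin j => if (i : ℕ) + 1 = j then L else K

/-- `K` and `L` are (positively) homothetic: `K = c L + t` with `c > 0`. -/
def Homothetic {n : ℕ} (K L : ConvexBody (E n)) : Prop :=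
  ∃ c : ℝ, 0 < c ∧ ∃ t : E n, (K : Set (E n)) = c • (L : Set (E n)) + {t}

end MixedAffine

end

/-!
Fix `ξ₀` and write the integrals over the Grassmannian as integrals over `O(n)`. On each projection,
Minkowski's first inequality `V(K, …, K, L) ≥ vol(K) ^ ((j - 1) / j) * vol(L) ^ (1 / j)` holds, and
Hölder's inequality passes it to the means of order `-n`.

Minkowski's inequality is the derivative at `t = 0` of the Brunn–Minkowski inequality for `K + t L`.
That `vol(K + t L)` is a polynomial in `t` is seen by parametrizing: the gradient of the
log-Laplace transform of a body `K` is a bijection onto the interior of `K` with symmetric positive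
definite Jacobian, so the sum of the gradients for `K` and `t L` parametrizes the interior of
`K + t L` and its Jacobian determinant is a polynomial in `t`. The Brunn–Minkowski inequality and
its equality case are proved by slicing, by induction on the dimension, with the one-dimensional
transport of section volumes as the inductive step.

In the equality case almost all, hence by continuity all, projections of `K` and `L` are homothetic,
with the same ratio `c`. So `h_K - c h_L` is linear on every `j`-dimensional subspace; any two
directions span a subspace of dimension at most `2 ≤ j`, so it is linear.
-/

noncomputable section

namespace MixedAffine

open Set Filter Topology

/-! ### The Prékopa–Leindler inequality on the line -/

section PrekopaLeindler

/-- A positive continuous density of total mass `k` on the bounded open interval `(α, β)`; nothing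
is assumed about the values of `f` outside the interval. -/
structure IsPosDensity (f : ℝ → ℝ) (α β k : ℝ) : Prop where
  lt : α < β
  continuousOn : ContinuousOn f (Ioo α β)
  pos : ∀ s ∈ Ioo α β, 0 < f s
  integrableOn : IntegrableOn f (Ioo α β)
  integral_eq : ∫ s in Ioo α β, f s = k

/-- The function `a : (0, 1) → (α, β)` is the quantile function of the density `f` of mass `k`: it
transports the uniform measure of mass `k` on `(0, 1)` to the measure with density `f`. -/
structure IsQuantile (a f : ℝ → ℝ) (α β k : ℝ) : Prop where
  image_eq : a '' Ioo 0 1 = Ioo α β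
  strictMonoOn : StrictMonoOn a (Ioo 0 1)
  hasDerivAt : ∀ θ ∈ Ioo (0 : ℝ) 1, HasDerivAt a (k / f (a θ)) θ

variable {f g a b : ℝ → ℝ} {α β γ δ k l p q : ℝ}

lemma IsPosDensity.mass_pos (hf : IsPosDensity f α β k) : 0 < k := by
  have hsupp : Ioo α β ⊆ Function.support f := fun s hs => (hf.pos s hs).ne'
  rw [← hf.integral_eq, setIntegral_pos_iff_support_of_nonneg_ae
    (ae_restrict_of_forall_mem measurableSet_Ioo fun s hs => (hf.pos s hs).le) hf.integrableOn,
    inter_eq_right.2 hsupp, Real.volume_Ioo]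
  exact ENNReal.ofReal_pos.2 (sub_pos.2 hf.lt)

lemma IsPosDensity.exists_primitive (hf : IsPosDensity f α β k) :
    ∃ F : ℝ → ℝ, ContinuousOn F (Icc α β) ∧ StrictMonoOn F (Icc α β) ∧ F α = 0 ∧ F β = k ∧
      ∀ s ∈ Ioo α β, HasDerivAt F (f s) s := by
  have hcont : ContinuousOn (fun s => ∫ x in α..s, f x) (Icc α β) := by
    have hint : IntegrableOn f (uIcc α β) := by
      rw [uIcc_of_le hf.lt.le, integrableOn_Icc_iff_integrableOn_Ioo]
      exact hf.integrableOn
    simpa only [uIcc_of_le hf.lt.le] using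
      intervalIntegral.continuousOn_primitive_interval hint
  have hderiv : ∀ s ∈ Ioo α β, HasDerivAt (fun s => ∫ x in α..s, f x) (f s) s := by
    intro s hs
    apply intervalIntegral.integral_hasDerivAt_right
    · rw [intervalIntegrable_iff_integrableOn_Ioo_of_le hs.1.le]
      exact hf.integrableOn.mono_set (Ioo_subset_Ioo_right hs.2.le)
    · exact hf.continuousOn.stronglyMeasurableAtFilter isOpen_Ioo s hs
    · exact hf.continuousOn.continuousAt (isOpen_Ioo.mem_nhds hs)
  refine ⟨_, hcont, strictMonoOn_of_deriv_pos (convex_Icc _ _) hcont fun s hs => ?_,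
    intervalIntegral.integral_same, ?_, hderiv⟩
  · rw [interior_Icc] at hs
    rw [(hderiv s hs).deriv]
    exact hf.pos s hs
  · rw [intervalIntegral.integral_of_le hf.lt.le, integral_Ioc_eq_integral_Ioo, hf.integral_eq]

lemma IsPosDensity.exists_isQuantile (hf : IsPosDensity f α β k) : ∃ a, IsQuantile a f α β k := by
  obtain ⟨F, hFc, hFm, hF0, hF1, hFd⟩ := hf.exists_primitive
  have hk := hf.mass_pos
  have hbij : BijOn (fun s => F s / k) (Ioo α β) (Ioo 0 1) := by
    have hm : StrictMonoOn (fun s => F s / k) (Icc α β) := fun s hs t ht hst =>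
      div_lt_div_of_pos_right (hFm hs ht hst) hk
    have hsurj := intermediate_value_Ioo hf.lt.le (hFc.div_const k)
    have hmaps := hm.mapsTo_Ioo
    simp only [hF0, hF1, zero_div, div_self hk.ne'] at hsurj hmaps
    exact ⟨hmaps, hm.injOn.mono Ioo_subset_Icc_self, hsurj⟩
  set a := Function.invFunOn (fun s => F s / k) (Ioo α β)
  have hinv : InvOn a (fun s => F s / k) (Ioo α β) (Ioo 0 1) := hbij.invOn_invFunOn
  have ha : BijOn a (Ioo 0 1) (Ioo α β) := hbij.symm hinv.symm
  have hmono : StrictMonoOn a (Ioo 0 1) := by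
    intro x hx y hy hxy
    rw [← hFm.lt_iff_lt (Ioo_subset_Icc_self (ha.mapsTo hx)) (Ioo_subset_Icc_self (ha.mapsTo hy)),
      ← div_lt_div_iff_of_pos_right hk]
    exact (hinv.2 hx).trans_lt (hxy.trans_eq (hinv.2 hy).symm)
  refine ⟨a, ha.image_eq, hmono, fun θ hθ => ?_⟩
  have hcont : ContinuousAt a θ := hmono.continuousAt_of_image_mem_nhds (isOpen_Ioo.mem_nhds hθ)
    (ha.image_eq ▸ isOpen_Ioo.mem_nhds (ha.mapsTo hθ))
  rw [← inv_div]
  exact ((hFd _ (ha.mapsTo hθ)).div_const k).of_local_left_inverse hcont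
    (div_pos (hf.pos _ (ha.mapsTo hθ)) hk).ne'
    (eventually_of_mem (isOpen_Ioo.mem_nhds hθ) hinv.2)

lemma IsQuantile.mem (ha : IsQuantile a f α β k) {θ : ℝ} (hθ : θ ∈ Ioo (0 : ℝ) 1) :
    a θ ∈ Ioo α β :=
  ha.image_eq ▸ mem_image_of_mem a hθ

lemma IsQuantile.continuousOn (ha : IsQuantile a f α β k) : ContinuousOn a (Ioo 0 1) :=
  fun θ hθ => (ha.hasDerivAt θ hθ).continuousAt.continuousWithinAt

lemma IsQuantile.exists_translation (ha : IsQuantile a f α β k) (hb : IsQuantile b g γ δ l)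
    (hαβ : α < β) (hγδ : γ < δ) (h : ∀ θ ∈ Ioo (0 : ℝ) 1, k / f (a θ) = l / g (b θ)) :
    ∃ c, α = γ + c ∧ β = δ + c ∧ ∀ s ∈ Ioo α β, f s / k = g (s - c) / l := by
  have hderiv : ∀ θ ∈ Ioo (0 : ℝ) 1, HasDerivAt (fun θ => a θ - b θ) 0 θ := fun θ hθ => by
    have := (ha.hasDerivAt θ hθ).sub (hb.hasDerivAt θ hθ)
    rwa [h θ hθ, sub_self] at this
  obtain ⟨c, hc⟩ : ∃ c, ∀ θ ∈ Ioo (0 : ℝ) 1, a θ - b θ = c :=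
    isOpen_Ioo.exists_is_const_of_deriv_eq_zero isPreconnected_Ioo
      (fun θ hθ => (hderiv θ hθ).differentiableAt.differentiableWithinAt)
      fun θ hθ => (hderiv θ hθ).deriv
  have hIoo : Ioo α β = Ioo (γ + c) (δ + c) := by
    rw [← image_add_const_Ioo, ← hb.image_eq, ← ha.image_eq, image_image]
    exact image_congr fun θ hθ => by linarith [hc θ hθ]
  have hα : α = γ + c := by
    rw [← csInf_Ioo hαβ, hIoo, csInf_Ioo (by linarith)]
  have hβ : β = δ + c := by
    rw [← csSup_Ioo hαβ, hIoo, csSup_Ioo (by linarith)]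
  refine ⟨c, hα, hβ, fun s hs => ?_⟩
  obtain ⟨θ, hθ, rfl⟩ := ha.image_eq.symm ▸ hs
  rw [← hc θ hθ, sub_sub_cancel, ← inv_div, h θ hθ, inv_div]

lemma rpow_mul_rpow_eq_div_rpow {x y : ℝ} (hk : 0 < k) (hl : 0 < l) (hx : 0 < x) (hy : 0 < y) :
    k ^ p * l ^ q = ((k / x) ^ p * (l / y) ^ q) * (x ^ p * y ^ q) := by
  rw [mul_mul_mul_comm, ← Real.mul_rpow (by positivity) hx.le,
    ← Real.mul_rpow (by positivity) hy.le, div_mul_cancel₀ _ hx.ne', div_mul_cancel₀ _ hy.ne']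

lemma rpow_mul_rpow_le_arith_mean_div {x y : ℝ} (hp : 0 ≤ p) (hq : 0 ≤ q) (hpq : p + q = 1)
    (hk : 0 < k) (hl : 0 < l) (hx : 0 < x) (hy : 0 < y) :
    k ^ p * l ^ q ≤ (p * (k / x) + q * (l / y)) * (x ^ p * y ^ q) := by
  rw [rpow_mul_rpow_eq_div_rpow hk hl hx hy]
  gcongr
  exact Real.geom_mean_le_arith_mean2_weighted hp hq (by positivity) (by positivity) hpq

lemma rpow_mul_rpow_eq_arith_mean_div_iff {x y : ℝ} (hp : 0 < p) (hq : 0 < q) (hpq : p + q = 1)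
    (hk : 0 < k) (hl : 0 < l) (hx : 0 < x) (hy : 0 < y) :
    k ^ p * l ^ q = (p * (k / x) + q * (l / y)) * (x ^ p * y ^ q) ↔ k / x = l / y := by
  rw [rpow_mul_rpow_eq_div_rpow hk hl hx hy, mul_left_inj' (by positivity),
    Real.geom_mean_eq_arith_mean2_weighted_iff_of_pos hp hq (by positivity) (by positivity) hpq]

/-- The lower bound for `h (p a(θ) + q b(θ)) (p a(θ) + q b(θ))'` in the transport proof of the
Prékopa–Leindler inequality. -/
def transportDensity (f g a b : ℝ → ℝ) (k l p q θ : ℝ) : ℝ :=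
  (p * (k / f (a θ)) + q * (l / g (b θ))) * (f (a θ) ^ p * g (b θ) ^ q)

variable (hf : IsPosDensity f α β k) (hg : IsPosDensity g γ δ l)
  (ha : IsQuantile a f α β k) (hb : IsQuantile b g γ δ l)

include hf hg ha hb

lemma le_transportDensity (hp : 0 ≤ p) (hq : 0 ≤ q) (hpq : p + q = 1) {θ : ℝ}
    (hθ : θ ∈ Ioo (0 : ℝ) 1) : k ^ p * l ^ q ≤ transportDensity f g a b k l p q θ :=
  rpow_mul_rpow_le_arith_mean_div hp hq hpq hf.mass_pos hg.mass_pos (hf.pos _ (ha.mem hθ))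
    (hg.pos _ (hb.mem hθ))

lemma continuousOn_transportDensity :
    ContinuousOn (transportDensity f g a b k l p q) (Ioo 0 1) := by
  have hfa : ContinuousOn (fun θ => f (a θ)) (Ioo 0 1) :=
    hf.continuousOn.comp ha.continuousOn fun θ hθ => ha.mem hθ
  have hgb : ContinuousOn (fun θ => g (b θ)) (Ioo 0 1) :=
    hg.continuousOn.comp hb.continuousOn fun θ hθ => hb.mem hθ
  have hfa0 : ∀ θ ∈ Ioo (0 : ℝ) 1, f (a θ) ≠ 0 := fun θ hθ => (hf.pos _ (ha.mem hθ)).ne'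
  have hgb0 : ∀ θ ∈ Ioo (0 : ℝ) 1, g (b θ) ≠ 0 := fun θ hθ => (hg.pos _ (hb.mem hθ)).ne'
  exact ((continuousOn_const.mul (continuousOn_const.div hfa hfa0)).add
    (continuousOn_const.mul (continuousOn_const.div hgb hgb0))).mul
    ((hfa.rpow_const fun θ hθ => Or.inl (hfa0 θ hθ)).mul
      (hgb.rpow_const fun θ hθ => Or.inl (hgb0 θ hθ)))

lemma lintegral_transportDensity_le (hp : 0 < p) (hq : 0 < q) {h : ℝ → ENNReal}
    (hh : ∀ s ∈ Ioo α β, ∀ t ∈ Ioo γ δ, ENNReal.ofReal (f s ^ p * g t ^ q) ≤ h (p * s + q * t)) :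
    ∫⁻ θ in Ioo (0 : ℝ) 1, ENNReal.ofReal (transportDensity f g a b k l p q θ) ≤ ∫⁻ s, h s := by
  have hmono : StrictMonoOn (fun θ => p * a θ + q * b θ) (Ioo 0 1) := fun x hx y hy hxy => by
    have := ha.strictMonoOn hx hy hxy
    have := hb.strictMonoOn hx hy hxy
    dsimp only
    gcongr
  have hderiv : ∀ θ ∈ Ioo (0 : ℝ) 1, HasDerivAt (fun θ => p * a θ + q * b θ)
      (p * (k / f (a θ)) + q * (l / g (b θ))) θ := fun θ hθ =>
    ((ha.hasDerivAt θ hθ).const_mul _).add ((hb.hasDerivAt θ hθ).const_mul _)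
  calc ∫⁻ θ in Ioo (0 : ℝ) 1, ENNReal.ofReal (transportDensity f g a b k l p q θ)
      ≤ ∫⁻ θ in Ioo (0 : ℝ) 1, ENNReal.ofReal |p * (k / f (a θ)) + q * (l / g (b θ))| *
          h (p * a θ + q * b θ) := by
        refine setLIntegral_mono' measurableSet_Ioo fun θ hθ => ?_
        have := hf.mass_pos
        have := hg.mass_pos
        have := hf.pos _ (ha.mem hθ)
        have := hg.pos _ (hb.mem hθ)
        have hnonneg : 0 ≤ p * (k / f (a θ)) + q * (l / g (b θ)) := by positivity
        rw [abs_of_nonneg hnonneg, transportDensity, ENNReal.ofReal_mul hnonneg]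
        gcongr
        exact hh _ (ha.mem hθ) _ (hb.mem hθ)
    _ = ∫⁻ s in (fun θ => p * a θ + q * b θ) '' Ioo 0 1, h s :=
        (lintegral_image_eq_lintegral_abs_deriv_mul measurableSet_Ioo
          (fun θ hθ => (hderiv θ hθ).hasDerivWithinAt) hmono.injOn h).symm
    _ ≤ ∫⁻ s, h s := setLIntegral_le_lintegral _ _

lemma transportDensity_eq_of_lintegral_le (hp : 0 ≤ p) (hq : 0 ≤ q) (hpq : p + q = 1)
    (h : ∫⁻ θ in Ioo (0 : ℝ) 1, ENNReal.ofReal (transportDensity f g a b k l p q θ) ≤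
      ENNReal.ofReal (k ^ p * l ^ q)) {θ : ℝ} (hθ : θ ∈ Ioo (0 : ℝ) 1) :
    k ^ p * l ^ q = transportDensity f g a b k l p q θ := by
  have hk := hf.mass_pos
  have hl := hg.mass_pos
  have hconst : ∫⁻ _ in Ioo (0 : ℝ) 1, ENNReal.ofReal (k ^ p * l ^ q) =
      ENNReal.ofReal (k ^ p * l ^ q) := by simp
  have hcont := continuousOn_transportDensity (p := p) (q := q) hf hg ha hb
  have hae := ae_eq_of_ae_le_of_lintegral_le
    (ae_restrict_of_forall_mem measurableSet_Ioo fun θ hθ =>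
      ENNReal.ofReal_le_ofReal (le_transportDensity hf hg ha hb hp hq hpq hθ))
    (by rw [hconst]; exact ENNReal.ofReal_ne_top)
    (hcont.aemeasurable measurableSet_Ioo).ennreal_ofReal
    (h.trans_eq hconst.symm)
  refine (ENNReal.ofReal_eq_ofReal_iff (by positivity) ?_).1 <|
    Measure.eqOn_open_of_ae_eq hae isOpen_Ioo continuousOn_const
      (ENNReal.continuous_ofReal.comp_continuousOn hcont) hθ
  exact (by positivity : 0 ≤ k ^ p * l ^ q).trans (le_transportDensity hf hg ha hb hp hq hpq hθ)

omit ha hb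

theorem prekopa_leindler (hp : 0 < p) (hq : 0 < q) (hpq : p + q = 1) {h : ℝ → ENNReal}
    (hh : ∀ s ∈ Ioo α β, ∀ t ∈ Ioo γ δ, ENNReal.ofReal (f s ^ p * g t ^ q) ≤ h (p * s + q * t)) :
    ENNReal.ofReal (k ^ p * l ^ q) ≤ ∫⁻ s, h s := by
  obtain ⟨a, ha⟩ := hf.exists_isQuantile
  obtain ⟨b, hb⟩ := hg.exists_isQuantile
  calc ENNReal.ofReal (k ^ p * l ^ q)
      = ∫⁻ _ in Ioo (0 : ℝ) 1, ENNReal.ofReal (k ^ p * l ^ q) := by simp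
    _ ≤ ∫⁻ θ in Ioo (0 : ℝ) 1, ENNReal.ofReal (transportDensity f g a b k l p q θ) :=
        setLIntegral_mono' measurableSet_Ioo fun θ hθ =>
          ENNReal.ofReal_le_ofReal (le_transportDensity hf hg ha hb hp.le hq.le hpq hθ)
    _ ≤ ∫⁻ s, h s := lintegral_transportDensity_le hf hg ha hb hp hq hh

theorem exists_translation_of_prekopa_leindler_eq (hp : 0 < p) (hq : 0 < q) (hpq : p + q = 1)
    {h : ℝ → ENNReal}
    (hh : ∀ s ∈ Ioo α β, ∀ t ∈ Ioo γ δ, ENNReal.ofReal (f s ^ p * g t ^ q) ≤ h (p * s + q * t))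
    (heq : ∫⁻ s, h s ≤ ENNReal.ofReal (k ^ p * l ^ q)) :
    ∃ c, α = γ + c ∧ β = δ + c ∧ ∀ s ∈ Ioo α β, f s / k = g (s - c) / l := by
  obtain ⟨a, ha⟩ := hf.exists_isQuantile
  obtain ⟨b, hb⟩ := hg.exists_isQuantile
  refine ha.exists_translation hb hf.lt hg.lt fun θ hθ => ?_
  exact (rpow_mul_rpow_eq_arith_mean_div_iff hp hq hpq hf.mass_pos hg.mass_pos
    (hf.pos _ (ha.mem hθ)) (hg.pos _ (hb.mem hθ))).1 <|
    transportDensity_eq_of_lintegral_le hf hg ha hb hp.le hq.le hpq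
      ((lintegral_transportDensity_le hf hg ha hb hp hq hh).trans heq) hθ

end PrekopaLeindler

/-! ### The Brunn–Minkowski inequality for convex bodies -/

/-- Convex bodies with interior points, as a predicate on sets (`ConvexBody` bundles nonempty
compact convex sets, without a condition on the interior). -/
structure IsSolidBody {F : Type*} [AddCommGroup F] [Module ℝ F] [TopologicalSpace F]
    (K : Set F) : Prop where
  isCompact : IsCompact K
  convex : Convex ℝ K
  interior_nonempty : (interior K).Nonempty

lemma IsSolidBody.nonempty {F : Type*} [AddCommGroup F] [Module ℝ F] [TopologicalSpace F]
    {K : Set F} (hK : IsSolidBody K) : K.Nonempty :=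
  hK.interior_nonempty.mono interior_subset

lemma IsSolidBody.measureReal_pos {F : Type*} [AddCommGroup F] [Module ℝ F] [TopologicalSpace F]
    [MeasurableSpace F] {K : Set F} (hK : IsSolidBody K) (μ : Measure F) [μ.IsOpenPosMeasure]
    [IsFiniteMeasureOnCompacts μ] : 0 < μ.real K :=
  ENNReal.toReal_pos (Measure.measure_pos_of_nonempty_interior μ hK.interior_nonempty).ne'
    hK.isCompact.measure_ne_top

lemma IsSolidBody.smul {F : Type*} [NormedAddCommGroup F] [NormedSpace ℝ F] {K : Set F}
    (hK : IsSolidBody K) {c : ℝ} (hc : c ≠ 0) : IsSolidBody (c • K) :=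
  ⟨hK.isCompact.smul c, hK.convex.smul c,
    (interior_smul₀ hc K).symm ▸ hK.interior_nonempty.smul_set⟩

lemma IsSolidBody.image {F G : Type*} [NormedAddCommGroup F] [NormedSpace ℝ F]
    [NormedAddCommGroup G] [NormedSpace ℝ G] {K : Set F} (hK : IsSolidBody K) (e : F ≃L[ℝ] G) :
    IsSolidBody (e '' K) :=
  ⟨hK.isCompact.image e.continuous, hK.convex.linear_image e.toLinearMap,
    (e.toHomeomorph.image_interior K) ▸ hK.interior_nonempty.image e⟩

lemma IsSolidBody.subset_closure_interior {F : Type*} [NormedAddCommGroup F] [NormedSpace ℝ F]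
    {K : Set F} (hK : IsSolidBody K) : K ⊆ closure (interior K) := by
  rw [hK.convex.closure_interior_eq_closure_of_nonempty_interior hK.interior_nonempty]
  exact subset_closure

/-- The multiplicative Brunn–Minkowski inequality for compact convex sets and the measure `μ`, as
a property of `μ` that is established by induction on the dimension. -/
def LogBrunnMinkowski {F : Type*} [AddCommGroup F] [Module ℝ F] [TopologicalSpace F]
    [MeasurableSpace F] (μ : Measure F) : Prop :=
  ∀ ⦃K L : Set F⦄, IsCompact K → Convex ℝ K → K.Nonempty → IsCompact L → Convex ℝ L →
    L.Nonempty → ∀ ⦃p q : ℝ⦄, 0 < p → 0 < q → p + q = 1 →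
      μ.real K ^ p * μ.real L ^ q ≤ μ.real (p • K + q • L)

section Sections

variable {G : Type*}

/-- The measure of the section of `K` over the first coordinate `s`. -/
def sectionVolume [MeasurableSpace G] (ν : Measure G) (K : Set (ℝ × G)) (s : ℝ) : ℝ :=
  ν.real (Prod.mk s ⁻¹' K)

lemma section_nonempty {K : Set (ℝ × G)} {s : ℝ} (hs : s ∈ Prod.fst '' K) :
    (Prod.mk s ⁻¹' K).Nonempty := by
  obtain ⟨⟨_, y⟩, hy, rfl⟩ := hs
  exact ⟨y, hy⟩

lemma sectionVolume_eq_zero [MeasurableSpace G] (ν : Measure G) {K : Set (ℝ × G)} {s : ℝ}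
    (hs : s ∉ Prod.fst '' K) : sectionVolume ν K s = 0 := by
  have hempty : Prod.mk s ⁻¹' K = ∅ := eq_empty_of_forall_notMem fun y hy => hs ⟨_, hy, rfl⟩
  rw [sectionVolume, hempty, measureReal_empty]

variable [NormedAddCommGroup G]

lemma isCompact_section {K : Set (ℝ × G)} (hK : IsCompact K) (s : ℝ) :
    IsCompact (Prod.mk s ⁻¹' K) :=
  (Topology.IsClosedEmbedding.of_continuous_injective_isClosedMap (by fun_prop)
    (Prod.mk_right_injective s) (isClosedMap_prodMk_left s)).isCompact_preimage hK

lemma sectionVolume_pos [MeasurableSpace G] {ν : Measure G} [ν.IsOpenPosMeasure]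
    [IsFiniteMeasureOnCompacts ν] {K : Set (ℝ × G)} (hK : IsCompact K)
    {s : ℝ} (hs : s ∈ Prod.fst '' interior K) : 0 < sectionVolume ν K s := by
  have hopen : IsOpen (Prod.mk s ⁻¹' interior K) := isOpen_interior.preimage (by fun_prop)
  have hpos : 0 < ν (Prod.mk s ⁻¹' interior K) := hopen.measure_pos ν (section_nonempty hs)
  exact ENNReal.toReal_pos
    (hpos.trans_le (measure_mono (preimage_mono interior_subset))).ne'
    (isCompact_section hK s).measure_ne_top

variable [NormedSpace ℝ G]

lemma convex_section {K : Set (ℝ × G)} (hK : Convex ℝ K) (s : ℝ) :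
    Convex ℝ (Prod.mk s ⁻¹' K) := by
  intro x hx y hy a b ha hb hab
  have hmem := hK hx hy ha hb hab
  rwa [Prod.smul_mk, Prod.smul_mk, Prod.mk_add_mk, ← add_smul, hab, one_smul] at hmem

lemma smul_section_add_smul_section_subset (K L : Set (ℝ × G)) (a b s t : ℝ) :
    a • (Prod.mk s ⁻¹' K) + b • (Prod.mk t ⁻¹' L) ⊆
      Prod.mk (a * s + b * t) ⁻¹' (a • K + b • L) := by
  rintro _ ⟨_, ⟨x, hx, rfl⟩, _, ⟨y, hy, rfl⟩, rfl⟩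
  exact ⟨_, ⟨_, hx, rfl⟩, _, ⟨_, hy, rfl⟩, by simp⟩

lemma IsSolidBody.exists_image_fst_eq_Icc {K : Set (ℝ × G)} (hK : IsSolidBody K) :
    ∃ α β, α < β ∧ Prod.fst '' K = Icc α β ∧ Ioo α β ⊆ Prod.fst '' interior K := by
  have hconn : IsConnected (Prod.fst '' K) :=
    (hK.convex.isConnected hK.nonempty).image _ continuous_fst.continuousOn
  have hI := eq_Icc_of_connected_compact hconn (hK.isCompact.image continuous_fst)
  set α := sInf (Prod.fst '' K)
  set β := sSup (Prod.fst '' K)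
  have hUo : IsOpen (Prod.fst '' interior K) := isOpenMap_fst _ isOpen_interior
  have hUc : Convex ℝ (Prod.fst '' interior K) :=
    hK.convex.interior.linear_image (LinearMap.fst ℝ ℝ G)
  have hUne : (Prod.fst '' interior K).Nonempty := hK.interior_nonempty.image _
  have hUsub : Prod.fst '' interior K ⊆ Ioo α β := by
    rw [← interior_Icc, ← hI]
    exact interior_maximal (image_mono interior_subset) hUo
  have hsub : Icc α β ⊆ closure (Prod.fst '' interior K) := by
    rw [← hI]
    exact (image_mono hK.subset_closure_interior).trans
      (image_closure_subset_closure_image continuous_fst)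
  refine ⟨α, β, ?_, hI, ?_⟩
  · obtain ⟨x, hx⟩ := hUne
    exact (hUsub hx).1.trans (hUsub hx).2
  · have hint := interior_mono hsub
    rwa [hUc.interior_closure_eq_interior_of_nonempty_interior (by rwa [hUo.interior_eq]),
      hUo.interior_eq, interior_Icc] at hint

variable [MeasurableSpace G] {ν : Measure G} {K L : Set (ℝ × G)} {α β : ℝ}

lemma LogBrunnMinkowski.rpow_mul_rpow_sectionVolume_le [IsFiniteMeasureOnCompacts ν]
    (hν : LogBrunnMinkowski ν) (hKc : IsCompact K) (hK : Convex ℝ K) (hLc : IsCompact L)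
    (hL : Convex ℝ L) {p q : ℝ} (hp : 0 < p) (hq : 0 < q) (hpq : p + q = 1) {s t : ℝ}
    (hs : s ∈ Prod.fst '' K) (ht : t ∈ Prod.fst '' L) :
    sectionVolume ν K s ^ p * sectionVolume ν L t ^ q ≤
      sectionVolume ν (p • K + q • L) (p * s + q * t) :=
  (hν (isCompact_section hKc s) (convex_section hK s) (section_nonempty hs)
    (isCompact_section hLc t) (convex_section hL t) (section_nonempty ht) hp hq hpq).trans <|
    measureReal_mono (smul_section_add_smul_section_subset K L p q s t)
      (isCompact_section ((hKc.smul p).add (hLc.smul q)) _).measure_ne_top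

lemma LogBrunnMinkowski.continuousOn_sectionVolume [IsFiniteMeasureOnCompacts ν]
    (hν : LogBrunnMinkowski ν) (hKc : IsCompact K) (hK : Convex ℝ K)
    (hsub : Ioo α β ⊆ Prod.fst '' K) (hpos : ∀ s ∈ Ioo α β, 0 < sectionVolume ν K s) :
    ContinuousOn (sectionVolume ν K) (Ioo α β) := by
  have hconcave : ConcaveOn ℝ (Ioo α β) fun s => Real.log (sectionVolume ν K s) := by
    refine concaveOn_iff_forall_pos.2 ⟨convex_Ioo _ _, fun s hs t ht p q hp hq hpq => ?_⟩
    have hs0 := hpos s hs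
    have ht0 := hpos t ht
    have hsum : p • K + q • K = K := by
      rw [← hK.add_smul hp.le hq.le, hpq, one_smul]
    have hle := hν.rpow_mul_rpow_sectionVolume_le hKc hK hKc hK hp hq hpq (hsub hs) (hsub ht)
    rw [hsum] at hle
    simp only [smul_eq_mul]
    rw [← Real.log_rpow hs0, ← Real.log_rpow ht0, ← Real.log_mul (by positivity) (by positivity)]
    exact Real.log_le_log (by positivity) hle
  exact (Real.continuous_exp.comp_continuousOn (hconcave.continuousOn isOpen_Ioo)).congr
    fun s hs => (Real.exp_log (hpos s hs)).symm

variable [FiniteDimensional ℝ G] [BorelSpace G]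

lemma integrable_mul_sectionVolume [SFinite ν] [IsFiniteMeasureOnCompacts ν] (hK : IsCompact K)
    {φ : ℝ → ℝ} (hφ : Continuous φ) :
    Integrable (fun s => φ s * sectionVolume ν K s) ∧
      ∫ s, φ s * sectionVolume ν K s = ∫ z in K, φ z.1 ∂((volume : Measure ℝ).prod ν) := by
  have hi : Integrable (K.indicator fun z => φ z.1) ((volume : Measure ℝ).prod ν) := by
    rw [integrable_indicator_iff hK.measurableSet]
    exact (hφ.comp continuous_fst).continuousOn.integrableOn_compact hK
  have hinner : ∀ s, ∫ y, K.indicator (fun z => φ z.1) (s, y) ∂ν = φ s * sectionVolume ν K s := by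
    intro s
    have hind : (fun y => K.indicator (fun z => φ z.1) (s, y)) =
        (Prod.mk s ⁻¹' K).indicator fun _ => φ s := rfl
    rw [hind, integral_indicator (isCompact_section hK s).measurableSet, setIntegral_const,
      smul_eq_mul, mul_comm, sectionVolume]
  refine ⟨by simpa only [hinner] using hi.integral_prod_left, ?_⟩
  rw [← integral_indicator hK.measurableSet, integral_prod _ hi]
  simp only [hinner]

lemma setIntegral_mul_sectionVolume [SFinite ν] [IsFiniteMeasureOnCompacts ν] (hK : IsCompact K)
    (hI : Prod.fst '' K = Icc α β) {φ : ℝ → ℝ} (hφ : Continuous φ) :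
    ∫ s in Ioo α β, φ s * sectionVolume ν K s =
      ∫ z in K, φ z.1 ∂((volume : Measure ℝ).prod ν) := by
  rw [← (integrable_mul_sectionVolume hK hφ).2, ← integral_Icc_eq_integral_Ioo, ← hI]
  refine setIntegral_eq_integral_of_forall_compl_eq_zero fun s hs => ?_
  rw [sectionVolume_eq_zero ν hs, mul_zero]

variable [ν.IsAddHaarMeasure]

lemma LogBrunnMinkowski.isPosDensity_sectionVolume (hν : LogBrunnMinkowski ν)
    (hK : IsSolidBody K) :
    ∃ α β, Prod.fst '' K = Icc α β ∧
      IsPosDensity (sectionVolume ν K) α β (((volume : Measure ℝ).prod ν).real K) := by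
  obtain ⟨α, β, hαβ, hI, hint⟩ := hK.exists_image_fst_eq_Icc
  have hpos : ∀ s ∈ Ioo α β, 0 < sectionVolume ν K s := fun s hs =>
    sectionVolume_pos hK.isCompact (hint hs)
  refine ⟨α, β, hI, hαβ, hν.continuousOn_sectionVolume hK.isCompact hK.convex
    (hI ▸ Ioo_subset_Icc_self) hpos, hpos, ?_, ?_⟩
  · simpa only [one_mul] using
      ((integrable_mul_sectionVolume (ν := ν) hK.isCompact
        (φ := fun _ => 1) continuous_const).1).integrableOn
  · simpa using setIntegral_mul_sectionVolume (ν := ν) hK.isCompact hI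
      (φ := fun _ => 1) continuous_const

lemma IsPosDensity.integral_mul_div_eq_add {f g : ℝ → ℝ} {γ δ k l c : ℝ}
    (hg : IsPosDensity g γ δ l) (hα : α = γ + c) (hβ : β = δ + c)
    (h : ∀ s ∈ Ioo α β, f s / k = g (s - c) / l) :
    (∫ s in Ioo α β, s * f s) / k = (∫ s in Ioo γ δ, s * g s) / l + c := by
  have hmul : IntegrableOn (fun s => s * g s) (Ioo γ δ) := by
    rw [← integrableOn_Icc_iff_integrableOn_Ioo]
    exact ((integrableOn_Icc_iff_integrableOn_Ioo).2 hg.integrableOn).continuousOn_mul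
      continuousOn_id isCompact_Icc
  have htranslate : ∫ s in Ioo α β, s * f s / k = ∫ s in Ioo γ δ, (s + c) * (g s / l) := by
    have hpre : (fun x => x + c) ⁻¹' Ioo α β = Ioo γ δ := by
      rw [hα, hβ, preimage_add_const_Ioo, add_sub_cancel_right, add_sub_cancel_right]
    rw [setIntegral_congr_fun (g := fun s => s * (g (s - c) / l)) measurableSet_Ioo fun s hs => by
      simp only [mul_div_assoc, h s hs], ← hpre, ← (measurePreserving_add_right volume
      c).setIntegral_preimage_emb (measurableEmbedding_addRight c)]
    simp only [add_sub_cancel_right]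
  calc (∫ s in Ioo α β, s * f s) / k
      = ∫ s in Ioo γ δ, (s * g s / l + c * (g s / l)) := by
        rw [← integral_div, htranslate]
        exact integral_congr_ae (ae_of_all _ fun s => by ring)
    _ = (∫ s in Ioo γ δ, s * g s) / l + c := by
        rw [integral_add (hmul.div_const l) ((hg.integrableOn.div_const l).const_mul c),
          integral_const_mul, integral_div, integral_div, hg.integral_eq,
          div_self hg.mass_pos.ne', mul_one]

variable (hν : LogBrunnMinkowski ν) (hK : IsSolidBody K) (hL : IsSolidBody L)
  {p q : ℝ} (hp : 0 < p) (hq : 0 < q) (hpq : p + q = 1)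
include hν hK hL hp hq hpq

theorem LogBrunnMinkowski.rpow_mul_rpow_prod_le :
    ((volume : Measure ℝ).prod ν).real K ^ p * ((volume : Measure ℝ).prod ν).real L ^ q ≤
      ((volume : Measure ℝ).prod ν).real (p • K + q • L) := by
  obtain ⟨α, β, hKI, hf⟩ := hν.isPosDensity_sectionVolume hK
  obtain ⟨γ, δ, hLI, hg⟩ := hν.isPosDensity_sectionVolume hL
  have hM : IsCompact (p • K + q • L) := (hK.isCompact.smul p).add (hL.isCompact.smul q)
  have hPL := prekopa_leindler hf hg hp hq hpq (h := fun s => ν (Prod.mk s ⁻¹' (p • K + q • L)))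
    fun s hs t ht => ENNReal.ofReal_le_of_le_toReal <|
      hν.rpow_mul_rpow_sectionVolume_le hK.isCompact hK.convex hL.isCompact hL.convex hp hq hpq
        (hKI ▸ Ioo_subset_Icc_self hs) (hLI ▸ Ioo_subset_Icc_self ht)
  rw [← Measure.prod_apply hM.measurableSet] at hPL
  exact (ENNReal.ofReal_le_iff_le_toReal hM.measure_ne_top).1 hPL

/-- The translation vector in the equality case is the difference of the centroids, which does not
refer to the direction of slicing. -/
theorem LogBrunnMinkowski.sSup_fst_sub_sSup_fst_eq_of_prod_le
    (h : ((volume : Measure ℝ).prod ν).real (p • K + q • L) ≤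
      ((volume : Measure ℝ).prod ν).real K ^ p * ((volume : Measure ℝ).prod ν).real L ^ q) :
    sSup (Prod.fst '' K) - sSup (Prod.fst '' L) =
      (⨍ z in K, z.1 ∂((volume : Measure ℝ).prod ν)) -
        ⨍ z in L, z.1 ∂((volume : Measure ℝ).prod ν) := by
  obtain ⟨α, β, hKI, hf⟩ := hν.isPosDensity_sectionVolume hK
  obtain ⟨γ, δ, hLI, hg⟩ := hν.isPosDensity_sectionVolume hL
  have hM : IsCompact (p • K + q • L) := (hK.isCompact.smul p).add (hL.isCompact.smul q)
  have hle : ∫⁻ s, ν (Prod.mk s ⁻¹' (p • K + q • L)) ≤ ENNReal.ofReal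
      (((volume : Measure ℝ).prod ν).real K ^ p * ((volume : Measure ℝ).prod ν).real L ^ q) := by
    rw [← Measure.prod_apply hM.measurableSet]
    exact (ENNReal.le_ofReal_iff_toReal_le hM.measure_ne_top (by positivity)).2 h
  obtain ⟨c, hα, hβ, hc⟩ := exists_translation_of_prekopa_leindler_eq hf hg hp hq hpq
    (fun s hs t ht => ENNReal.ofReal_le_of_le_toReal <|
      hν.rpow_mul_rpow_sectionVolume_le hK.isCompact hK.convex hL.isCompact hL.convex hp hq hpq
        (hKI ▸ Ioo_subset_Icc_self hs) (hLI ▸ Ioo_subset_Icc_self ht)) hle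
  have hcentroid := hg.integral_mul_div_eq_add hα hβ hc
  rw [setIntegral_mul_sectionVolume hK.isCompact hKI (φ := fun s => s) continuous_id,
    setIntegral_mul_sectionVolume hL.isCompact hLI (φ := fun s => s) continuous_id] at hcentroid
  simp only [div_eq_inv_mul] at hcentroid
  rw [hKI, hLI, csSup_Icc hf.lt.le, csSup_Icc hg.lt.le, setAverage_eq, setAverage_eq, smul_eq_mul,
    smul_eq_mul, hcentroid, hβ]
  ring

end Sections

section BrunnMinkowski

variable {F : Type*} [NormedAddCommGroup F] [NormedSpace ℝ F]

/-- The support function of a set, as a function on the dual space. -/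
def suppFn (K : Set F) (u : F →L[ℝ] ℝ) : ℝ := sSup (u '' K)

lemma le_suppFn {K : Set F} (hK : IsCompact K) (u : F →L[ℝ] ℝ) {x : F} (hx : x ∈ K) :
    u x ≤ suppFn K u :=
  le_csSup (hK.image u.continuous).bddAbove ⟨x, hx, rfl⟩

lemma exists_suppFn_eq {K : Set F} (hK : IsCompact K) (hne : K.Nonempty) (u : F →L[ℝ] ℝ) :
    ∃ x ∈ K, suppFn K u = u x := by
  obtain ⟨x, hx, h⟩ := (hK.image u.continuous).sSup_mem (hne.image u)
  exact ⟨x, hx, h.symm⟩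

lemma suppFn_zero {K : Set F} (hne : K.Nonempty) : suppFn K 0 = 0 := by
  simp [suppFn, hne.image_const]

lemma suppFn_image {F' : Type*} [NormedAddCommGroup F'] [NormedSpace ℝ F'] (A : F' →L[ℝ] F)
    (K : Set F') (u : F →L[ℝ] ℝ) : suppFn (A '' K) u = suppFn K (u.comp A) := by
  rw [suppFn, image_image]; rfl

lemma suppFn_smul {c : ℝ} (hc : 0 ≤ c) (K : Set F) (u : F →L[ℝ] ℝ) :
    suppFn (c • K) u = c * suppFn K u := by
  rw [suppFn, image_smul_set, Real.sSup_smul_of_nonneg hc, suppFn, smul_eq_mul]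

lemma subset_of_suppFn_le {K L : Set F} (hK : IsCompact K) (hL : IsCompact L) (hLc : Convex ℝ L)
    (hne : L.Nonempty) (h : ∀ u, suppFn K u ≤ suppFn L u) : K ⊆ L := by
  intro x hx
  by_contra hxL
  obtain ⟨u, r, hur, hrx⟩ := geometric_hahn_banach_closed_point hLc hL.isClosed hxL
  obtain ⟨y, hy, huy⟩ := exists_suppFn_eq hL hne u
  linarith [h u, le_suppFn hK u hx, hur y hy]

variable [FiniteDimensional ℝ F]

lemma finrank_ker_add_one {u : F →L[ℝ] ℝ} (hu : u ≠ 0) :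
    Module.finrank ℝ u.ker + 1 = Module.finrank ℝ F :=
  Module.Dual.finrank_ker_add_one_of_ne_zero (f := (u : F →ₗ[ℝ] ℝ)) fun h =>
    hu (ContinuousLinearMap.coe_injective h)

variable [MeasurableSpace F] (μ : Measure F) [μ.IsAddHaarMeasure]

lemma logBrunnMinkowski_of_finrank_eq_zero (hF : Module.finrank ℝ F = 0) :
    LogBrunnMinkowski μ := by
  intro K L _ _ hK _ _ hL p q _ _ hpq
  have : Subsingleton F := Module.finrank_zero_iff.1 hF
  rw [Subsingleton.eq_univ_of_nonempty hK, Subsingleton.eq_univ_of_nonempty hL,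
    Subsingleton.eq_univ_of_nonempty (univ_nonempty.smul_set.add univ_nonempty.smul_set),
    ← Real.rpow_add, hpq, Real.rpow_one]
  exact ENNReal.toReal_pos (isOpen_univ.measure_pos μ univ_nonempty).ne'
    subsingleton_univ.isCompact.measure_ne_top

variable [BorelSpace F]

lemma exists_slicing {u : F →L[ℝ] ℝ} (hu : u ≠ 0) :
    ∃ (e : F ≃L[ℝ] ℝ × u.ker) (ν : Measure u.ker), ν.IsAddHaarMeasure ∧
      (∀ x, (e x).1 = u x) ∧ μ.map e = (volume : Measure ℝ).prod ν := by
  obtain ⟨x, hx⟩ : ∃ x, u x ≠ 0 := by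
    by_contra! h
    exact hu (by ext x; simpa using h x)
  let v : ℝ →L[ℝ] F := ContinuousLinearMap.toSpanSingleton ℝ ((u x)⁻¹ • x)
  have hv : Function.RightInverse v u := by
    intro t
    simp [v, hx]
  let e := ContinuousLinearEquiv.equivOfRightInverse u v hv
  let ν : Measure u.ker := Measure.addHaar
  have : (μ.map e).IsAddHaarMeasure := e.isAddHaarMeasure_map μ
  have hc : 0 < Measure.addHaarScalarFactor (μ.map e) ((volume : Measure ℝ).prod ν) :=
    Measure.addHaarScalarFactor_pos_of_isAddHaarMeasure _ _
  refine ⟨e, (Measure.addHaarScalarFactor (μ.map e) (volume.prod ν) : ENNReal) • ν,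
    .smul _ (by exact_mod_cast hc.ne') ENNReal.coe_ne_top, fun _ => rfl, ?_⟩
  rw [Measure.prod_smul_right]
  exact Measure.isAddLeftInvariant_eq_smul _ _

variable {μ} in
lemma isSolidBody_of_measureReal_pos {K : Set F} (hKc : IsCompact K) (hK : Convex ℝ K)
    (h : 0 < μ.real K) : IsSolidBody K := by
  refine ⟨hKc, hK, ?_⟩
  by_contra! hint
  have hfrontier : K ⊆ frontier K := by
    rw [frontier, hint, sdiff_empty]
    exact subset_closure
  rw [Measure.real, measure_mono_null hfrontier (hK.addHaar_frontier μ),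
    ENNReal.toReal_zero] at h
  exact h.false

section Slicing

variable {u : F →L[ℝ] ℝ} (hu : u ≠ 0)
  (hker : ∀ ν : Measure u.ker, ν.IsAddHaarMeasure → LogBrunnMinkowski ν)
  {K L : Set F} (hK : IsSolidBody K) (hL : IsSolidBody L)
  {p q : ℝ} (hp : 0 < p) (hq : 0 < q) (hpq : p + q = 1)
include hu hker hK hL hp hq hpq

lemma logBrunnMinkowski_of_ker :
    μ.real K ^ p * μ.real L ^ q ≤ μ.real (p • K + q • L) := by
  obtain ⟨e, ν, hν, -, hmap⟩ := exists_slicing μ hu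
  have hemb : MeasurableEmbedding e := e.toHomeomorph.measurableEmbedding
  have hreal (M : Set F) : (volume.prod ν).real (e '' M) = μ.real M := by
    rw [← hmap, Measure.real, hemb.map_apply, e.injective.preimage_image M, Measure.real]
  have h := (hker ν hν).rpow_mul_rpow_prod_le (hK.image e) (hL.image e) hp hq hpq
  rwa [← image_smul_set, ← image_smul_set, ← image_add, hreal, hreal, hreal] at h

lemma suppFn_sub_suppFn_eq_of_ker (h : μ.real (p • K + q • L) ≤ μ.real K ^ p * μ.real L ^ q) :
    suppFn K u - suppFn L u = (⨍ x in K, u x ∂μ) - ⨍ x in L, u x ∂μ := by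
  obtain ⟨e, ν, hν, heu, hmap⟩ := exists_slicing μ hu
  have hemb : MeasurableEmbedding e := e.toHomeomorph.measurableEmbedding
  have hreal (M : Set F) : (volume.prod ν).real (e '' M) = μ.real M := by
    rw [← hmap, Measure.real, hemb.map_apply, e.injective.preimage_image M, Measure.real]
  have haverage (M : Set F) : ⨍ z in e '' M, z.1 ∂(volume.prod ν) = ⨍ x in M, u x ∂μ := by
    rw [setAverage_eq, setAverage_eq, hreal, ← hmap, hemb.setIntegral_map,
      e.injective.preimage_image M]
    simp only [heu]
  have hsupp (M : Set F) : sSup (Prod.fst '' (e '' M)) = suppFn M u := by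
    rw [image_image, suppFn]
    simp only [heu]
  have hslice := (hker ν hν).sSup_fst_sub_sSup_fst_eq_of_prod_le (hK.image e) (hL.image e) hp hq hpq
  rw [← image_smul_set, ← image_smul_set, ← image_add, hreal, hreal, hreal, haverage, haverage,
    hsupp, hsupp] at hslice
  exact hslice h

end Slicing

theorem logBrunnMinkowski : LogBrunnMinkowski μ := by
  obtain ⟨d, hd⟩ : ∃ d, Module.finrank ℝ F = d := ⟨_, rfl⟩
  induction d generalizing F with
  | zero => exact logBrunnMinkowski_of_finrank_eq_zero μ hd
  | succ d ih =>
    intro K L hKc hK _ hLc hL _ p q hp hq hpq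
    rcases (measureReal_nonneg (μ := μ) (s := K)).eq_or_lt with hK0 | hK0
    · rw [← hK0, Real.zero_rpow hp.ne', zero_mul]
      exact measureReal_nonneg
    rcases (measureReal_nonneg (μ := μ) (s := L)).eq_or_lt with hL0 | hL0
    · rw [← hL0, Real.zero_rpow hq.ne', mul_zero]
      exact measureReal_nonneg
    have : Nontrivial F := Module.nontrivial_of_finrank_pos (R := ℝ) (by lia)
    obtain ⟨x, hx⟩ := exists_ne (0 : F)
    obtain ⟨u, hu⟩ := SeparatingDual.exists_ne_zero (R := ℝ) hx
    have hu0 : u ≠ 0 := by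
      rintro rfl
      exact hu rfl
    exact logBrunnMinkowski_of_ker μ hu0
      (fun ν _ => ih ν (by have := finrank_ker_add_one hu0; lia))
      (isSolidBody_of_measureReal_pos hKc hK hK0) (isSolidBody_of_measureReal_pos hLc hL hL0)
      hp hq hpq

lemma measureReal_smul_of_nonneg {c : ℝ} (hc : 0 ≤ c) (K : Set F) :
    μ.real (c • K) = c ^ Module.finrank ℝ F * μ.real K := by
  rw [Measure.real, Measure.addHaar_smul, ENNReal.toReal_mul,
    ENNReal.toReal_ofReal (abs_nonneg _), abs_of_nonneg (by positivity), Measure.real]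

lemma measureReal_inv_smul_eq_one {k : ℝ} (hk : 0 < k) {K : Set F}
    (hKk : μ.real K = k ^ Module.finrank ℝ F) : μ.real (k⁻¹ • K) = 1 := by
  rw [measureReal_smul_of_nonneg μ (by positivity), hKk, ← mul_pow, inv_mul_cancel₀ hk.ne', one_pow]

lemma measureReal_convex_combination {k l : ℝ} (hk : 0 < k) (hl : 0 < l) (K L : Set F) :
    μ.real ((k / (k + l)) • k⁻¹ • K + (l / (k + l)) • l⁻¹ • L) =
      μ.real (K + L) / (k + l) ^ Module.finrank ℝ F := by
  have hsum : (k / (k + l)) • k⁻¹ • K + (l / (k + l)) • l⁻¹ • L = (k + l)⁻¹ • (K + L) := by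
    rw [smul_smul, smul_smul, smul_add]
    congr 2 <;> field_simp
  rw [hsum, measureReal_smul_of_nonneg μ (by positivity), inv_pow, inv_mul_eq_div]

variable {K L : Set F} (hK : IsSolidBody K) (hL : IsSolidBody L)
include hK hL

theorem exists_suppFn_eq_add_of_logBrunnMinkowski_eq {p q : ℝ} (hp : 0 < p) (hq : 0 < q)
    (hpq : p + q = 1) (h : μ.real (p • K + q • L) ≤ μ.real K ^ p * μ.real L ^ q) :
    ∃ t : F, ∀ u : F →L[ℝ] ℝ, suppFn K u = suppFn L u + u t := by
  refine ⟨(⨍ x in K, x ∂μ) - ⨍ x in L, x ∂μ, fun u => ?_⟩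
  rcases eq_or_ne u 0 with rfl | hu
  · simp [suppFn_zero hK.nonempty, suppFn_zero hL.nonempty]
  have haverage {M : Set F} (hM : IsCompact M) : ⨍ x in M, u x ∂μ = u (⨍ x in M, x ∂μ) := by
    rw [setAverage_eq, setAverage_eq, map_smul]
    exact congrArg _
      (u.integral_comp_comm (continuous_id.continuousOn.integrableOn_compact hM))
  have hsub := suppFn_sub_suppFn_eq_of_ker μ hu (fun ν _ => logBrunnMinkowski ν) hK hL hp hq hpq h
  rw [haverage hK.isCompact, haverage hL.isCompact, ← map_sub] at hsub
  linarith

variable {k l : ℝ} (hk : 0 < k) (hl : 0 < l) (hKk : μ.real K = k ^ Module.finrank ℝ F)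
  (hLl : μ.real L = l ^ Module.finrank ℝ F)
include hk hl hKk hLl

theorem brunnMinkowski : (k + l) ^ Module.finrank ℝ F ≤ μ.real (K + L) := by
  have h := logBrunnMinkowski μ (hK.isCompact.smul k⁻¹) (hK.convex.smul k⁻¹) hK.nonempty.smul_set
    (hL.isCompact.smul l⁻¹) (hL.convex.smul l⁻¹) hL.nonempty.smul_set
    (p := k / (k + l)) (q := l / (k + l)) (by positivity) (by positivity) (by field_simp)
  rwa [measureReal_inv_smul_eq_one μ hk hKk, measureReal_inv_smul_eq_one μ hl hLl, Real.one_rpow,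
    Real.one_rpow, one_mul, measureReal_convex_combination μ hk hl,
    one_le_div (by positivity)] at h

theorem exists_suppFn_div_eq_of_brunnMinkowski_eq
    (h : μ.real (K + L) ≤ (k + l) ^ Module.finrank ℝ F) :
    ∃ t : F, ∀ u : F →L[ℝ] ℝ, suppFn K u / k = suppFn L u / l + u t := by
  obtain ⟨t, ht⟩ := exists_suppFn_eq_add_of_logBrunnMinkowski_eq μ (hK.smul (inv_ne_zero hk.ne'))
    (hL.smul (inv_ne_zero hl.ne')) (p := k / (k + l)) (q := l / (k + l)) (by positivity)
    (by positivity) (by field_simp) <| by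
      rwa [measureReal_inv_smul_eq_one μ hk hKk, measureReal_inv_smul_eq_one μ hl hLl,
        Real.one_rpow, Real.one_rpow, one_mul, measureReal_convex_combination μ hk hl,
        div_le_one (by positivity)]
  refine ⟨t, fun u => ?_⟩
  have hu := ht u
  rwa [suppFn_smul (by positivity), suppFn_smul (by positivity), ← div_eq_inv_mul,
    ← div_eq_inv_mul] at hu

end BrunnMinkowski

/-! ### The logarithmic Laplace transform of a convex body -/

section LogLaplace

open scoped RealInnerProductSpace
open ProbabilityTheory

variable {F V : Type*} [NormedAddCommGroup F] [InnerProductSpace ℝ F]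
  [NormedAddCommGroup V] [NormedSpace ℝ V]

lemma continuous_innerSL_smulRight {X : Type*} [TopologicalSpace X] {c : X → F} {g : X → V}
    (hc : Continuous c) (hg : Continuous g) :
    Continuous fun y => (innerSL ℝ (c y)).smulRight (g y) :=
  (ContinuousLinearMap.smulRightL ℝ F V).continuous₂.comp
    (((innerSL ℝ).continuous.comp hc).prodMk hg)

lemma hasFDerivAt_inner_left (y x : F) : HasFDerivAt (fun z : F => ⟪z, y⟫) (innerSL ℝ y) x := by
  simp only [← real_inner_comm]
  exact (innerSL ℝ y).hasFDerivAt

variable [FiniteDimensional ℝ F] [MeasurableSpace F] [BorelSpace F]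

lemma hasFDerivAt_integral_exp_inner_smul {μ : Measure F} [IsFiniteMeasureOnCompacts μ]
    {K : Set F} (hK : IsCompact K) {g : F → V} (hg : Continuous g) (x : F) :
    HasFDerivAt (fun x => ∫ y in K, Real.exp ⟪x, y⟫ • g y ∂μ)
      (∫ y in K, Real.exp ⟪x, y⟫ • (innerSL ℝ y).smulRight (g y) ∂μ) x := by
  have hcont : Continuous fun z : F × F =>
      Real.exp ⟪z.1, z.2⟫ • (innerSL ℝ z.2).smulRight (g z.2) :=
    (Real.continuous_exp.comp (continuous_fst.inner continuous_snd)).smul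
      (continuous_innerSL_smulRight continuous_snd (hg.comp continuous_snd))
  have hderiv (y z : F) : HasFDerivAt (fun z => Real.exp ⟪z, y⟫ • g y)
      (Real.exp ⟪z, y⟫ • (innerSL ℝ y).smulRight (g y)) z := by
    convert (hasFDerivAt_inner_left y z).exp.smul_const (g y) using 1
    ext v
    simp [smul_smul]
  obtain ⟨C, hC⟩ := ((isCompact_closedBall x 1).prod hK).exists_bound_of_continuousOn
    hcont.continuousOn
  exact hasFDerivAt_integral_of_dominated_of_fderiv_le (bound := fun _ => C)
    (F' := fun x y => Real.exp ⟪x, y⟫ • (innerSL ℝ y).smulRight (g y))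
    (Metric.closedBall_mem_nhds x one_pos)
    (Eventually.of_forall fun z => Continuous.aestronglyMeasurable (by fun_prop))
    (ContinuousOn.integrableOn_compact hK (by fun_prop))
    (hcont.comp (by fun_prop : Continuous fun y => (x, y))).aestronglyMeasurable
    (ae_restrict_of_forall_mem hK.measurableSet fun y hy z hz => hC (z, y) ⟨hz, hy⟩)
    (integrableOn_const hK.measure_ne_top) (Eventually.of_forall fun y z _ => hderiv y z)

/-- The Laplace transform of the uniform measure on `K`. -/
def laplace (K : Set F) (x : F) : ℝ := ∫ y in K, Real.exp ⟪x, y⟫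

/-- The probability measure on `K` with density proportional to `exp ⟪x, ·⟫`. -/
def tilted (K : Set F) (x : F) : Measure F := (volume.restrict K).tilted fun y => ⟪x, y⟫

/-- The mean of the tilted measure, which is the gradient of the logarithmic Laplace transform. -/
def tiltedMean (K : Set F) (x : F) : F := ∫ y, y ∂tilted K x

/-- The covariance of the tilted measure, which is the Hessian of the logarithmic Laplace
transform. The measure is recentred because `covarianceOperator` consists of second moments. -/
def tiltedCovariance (K : Set F) (x : F) : F →L[ℝ] F :=
  covarianceOperator ((tilted K x).map fun y => y - tiltedMean K x)

lemma integral_tilted_eq [CompleteSpace V] (K : Set F) (x : F) (g : F → V) :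
    ∫ y, g y ∂tilted K x = (laplace K x)⁻¹ • ∫ y in K, Real.exp ⟪x, y⟫ • g y := by
  rw [tilted, integral_tilted, ← integral_smul]
  simp only [div_eq_inv_mul, mul_smul, laplace]

variable {K : Set F}

lemma integrable_exp_inner (hK : IsCompact K) (x : F) :
    IntegrableOn (fun y => Real.exp ⟪x, y⟫) K :=
  ContinuousOn.integrableOn_compact hK (by fun_prop)

lemma integrable_tilted (hK : IsCompact K) {g : F → V} (hg : Continuous g) (x : F) :
    Integrable g (tilted K x) :=
  (integrable_tilted_iff (integrable_exp_inner hK x) g).2 <|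
    ContinuousOn.integrableOn_compact hK (by fun_prop)

variable (hK : IsSolidBody K) (x : F)
include hK

lemma IsSolidBody.neZero_restrict : NeZero ((volume : Measure F).restrict K) :=
  ⟨by
    rw [Ne, Measure.restrict_eq_zero]
    exact (Measure.measure_pos_of_nonempty_interior _ hK.interior_nonempty).ne'⟩

lemma IsSolidBody.isProbabilityMeasure_tilted : IsProbabilityMeasure (tilted K x) :=
  have := hK.neZero_restrict
  MeasureTheory.isProbabilityMeasure_tilted (integrable_exp_inner hK.isCompact x)

lemma laplace_pos : 0 < laplace K x :=
  have := hK.neZero_restrict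
  integral_exp_pos (integrable_exp_inner hK.isCompact x)

lemma tiltedMean_mem : tiltedMean K x ∈ K := by
  have := hK.isProbabilityMeasure_tilted x
  refine hK.convex.integral_mem hK.isCompact.isClosed ?_
    (integrable_tilted hK.isCompact continuous_id' x)
  exact (tilted_absolutelyContinuous _ _).ae_le (ae_restrict_mem hK.isCompact.measurableSet)

section IntegralTilted

variable [CompleteSpace V] {g : F → V} (hg : Continuous g)
include hg

lemma hasFDerivAt_integral_exp_inner_smul' :
    HasFDerivAt (fun x => ∫ y in K, Real.exp ⟪x, y⟫ • g y)
      (laplace K x • ∫ y, (innerSL ℝ y).smulRight (g y) ∂tilted K x) x := by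
  rw [integral_tilted_eq, smul_inv_smul₀ (laplace_pos hK x).ne']
  exact hasFDerivAt_integral_exp_inner_smul hK.isCompact hg x

lemma integral_innerSL_sub_smulRight_tilted (a : F) :
    ∫ y, (innerSL ℝ (y - a)).smulRight (g y) ∂tilted K x =
      (∫ y, (innerSL ℝ y).smulRight (g y) ∂tilted K x) -
        (innerSL ℝ a).smulRight (∫ y, g y ∂tilted K x) := by
  have hint {c : F → F} (hc : Continuous c) :
      Integrable (fun y => (innerSL ℝ (c y)).smulRight (g y)) (tilted K x) :=
    integrable_tilted hK.isCompact (continuous_innerSL_smulRight hc hg) x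
  have ha : (innerSL ℝ a).smulRight (∫ y, g y ∂tilted K x) =
      ∫ y, (innerSL ℝ a).smulRight (g y) ∂tilted K x :=
    ((ContinuousLinearMap.smulRightL ℝ F V (innerSL ℝ a)).integral_comp_comm
      (integrable_tilted hK.isCompact hg x)).symm
  rw [ha, ← integral_sub (hint continuous_id') (hint continuous_const)]
  congr 1 with y v
  simp [sub_smul]

end IntegralTilted

lemma hasFDerivAt_laplace :
    HasFDerivAt (laplace K) (laplace K x • innerSL ℝ (tiltedMean K x)) x := by
  have h := hasFDerivAt_integral_exp_inner_smul' hK x (g := fun _ => (1 : ℝ)) continuous_const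
  simp only [smul_eq_mul, mul_one] at h
  refine h.congr_fderiv ?_
  rw [tiltedMean,
    ← (innerSL ℝ).integral_comp_comm (integrable_tilted hK.isCompact continuous_id' x)]
  congr 2 with y v
  exact mul_one _

lemma hasFDerivAt_log_laplace :
    HasFDerivAt (fun x => Real.log (laplace K x)) (innerSL ℝ (tiltedMean K x)) x := by
  have h := (hasFDerivAt_laplace hK x).log (laplace_pos hK x).ne'
  rwa [smul_smul, inv_mul_cancel₀ (laplace_pos hK x).ne', one_smul] at h

lemma hasFDerivAt_integral_tilted [CompleteSpace V] {g : F → V} (hg : Continuous g) :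
    HasFDerivAt (fun x => ∫ y, g y ∂tilted K x)
      (∫ y, (innerSL ℝ (y - tiltedMean K x)).smulRight (g y) ∂tilted K x) x := by
  have hZ := (laplace_pos hK x).ne'
  have h := ((hasDerivAt_inv hZ).comp_hasFDerivAt x (hasFDerivAt_laplace hK x)).smul
    (hasFDerivAt_integral_exp_inner_smul' hK x hg)
  rw [integral_innerSL_sub_smulRight_tilted hK x hg]
  simp only [integral_tilted_eq K _ g]
  refine h.congr_fderiv ?_
  ext v
  simp only [add_apply, sub_apply, smul_apply, ContinuousLinearMap.smulRight_apply,
    innerSL_apply_apply, Function.comp_apply]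
  rw [inv_smul_smul₀ hZ]
  rw [sub_eq_add_neg, smul_smul, ← neg_smul, smul_smul]
  congr 2
  rw [smul_eq_mul]
  field_simp

lemma memLp_map_sub_tiltedMean :
    MemLp id 2 ((tilted K x).map fun y => y - tiltedMean K x) := by
  have := hK.isProbabilityMeasure_tilted x
  rw [memLp_map_measure_iff aestronglyMeasurable_id (by fun_prop),
    memLp_two_iff_integrable_sq_norm (by fun_prop)]
  exact integrable_tilted hK.isCompact (by fun_prop) x

lemma tiltedCovariance_apply (v : F) : tiltedCovariance K x v =
    ∫ y, ⟪v, y - tiltedMean K x⟫ • (y - tiltedMean K x) ∂tilted K x := by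
  rw [tiltedCovariance, covarianceOperator_apply (memLp_map_sub_tiltedMean hK x),
    integral_map (by fun_prop) (by fun_prop)]

lemma inner_tiltedCovariance (v : F) : ⟪tiltedCovariance K x v, v⟫ =
    ∫ y, ⟪v, y - tiltedMean K x⟫ ^ 2 ∂tilted K x := by
  rw [tiltedCovariance, covarianceOperator_inner (memLp_map_sub_tiltedMean hK x),
    integral_map (by fun_prop) (by fun_prop)]
  simp only [sq]

lemma hasFDerivAt_tiltedMean : HasFDerivAt (tiltedMean K) (tiltedCovariance K x) x := by
  have hmean : tiltedMean K = fun z => ∫ y, (y - tiltedMean K x) ∂tilted K z + tiltedMean K x := by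
    funext z
    have := hK.isProbabilityMeasure_tilted z
    rw [integral_sub (integrable_tilted hK.isCompact continuous_id' z) (integrable_const _),
      integral_const, probReal_univ, one_smul, sub_add_cancel, tiltedMean]
  have hcov : tiltedCovariance K x =
      ∫ y, (innerSL ℝ (y - tiltedMean K x)).smulRight (y - tiltedMean K x) ∂tilted K x := by
    ext1 v
    rw [tiltedCovariance_apply hK, ContinuousLinearMap.integral_apply (integrable_tilted
      hK.isCompact (continuous_innerSL_smulRight (by fun_prop) (by fun_prop)) x)]
    simp only [ContinuousLinearMap.smulRight_apply, innerSL_apply_apply, real_inner_comm v]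
  rw [hcov]
  exact ((hasFDerivAt_integral_tilted hK x (g := fun y => y - tiltedMean K x)
    (by fun_prop)).add_const _).congr_of_eventuallyEq (.of_eq hmean)

lemma inner_tiltedCovariance_pos {v : F} (hv : v ≠ 0) : 0 < ⟪tiltedCovariance K x v, v⟫ := by
  rw [inner_tiltedCovariance hK]
  refine (integral_nonneg fun y => sq_nonneg _).lt_of_ne' fun hzero => hv ?_
  rw [integral_eq_zero_iff_of_nonneg (fun y => sq_nonneg _)
    (integrable_tilted hK.isCompact
      ((by fun_prop : Continuous fun y => ⟪v, y - tiltedMean K x⟫).pow 2) x)] at hzero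
  have hconst : EqOn (fun y => ⟪y, v⟫) (fun _ => ⟪tiltedMean K x, v⟫) (interior K) := by
    have hae := (absolutelyContinuous_tilted (integrable_exp_inner hK.isCompact x)).ae_le hzero
    refine Measure.eqOn_open_of_ae_eq (μ := volume)
      (ae_restrict_of_ae_restrict_of_subset interior_subset ?_) isOpen_interior
      (by fun_prop) continuousOn_const
    filter_upwards [hae] with y hy
    rwa [Pi.zero_apply, sq_eq_zero_iff, inner_sub_right, sub_eq_zero, real_inner_comm,
      real_inner_comm _ v] at hy
  obtain ⟨y, hy⟩ := hK.interior_nonempty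
  have hderiv := (hasFDerivAt_inner_left v y).congr_of_eventuallyEq
    (hconst.symm.eventuallyEq_of_mem (isOpen_interior.mem_nhds hy))
  have hv : innerSL ℝ v v = 0 := by
    rw [hderiv.unique (hasFDerivAt_const _ y), zero_apply]
  exact inner_self_eq_zero.1 hv

lemma le_laplace_of_ball_subset {p : F} {ρ : ℝ} (hball : Metric.ball p ρ ⊆ K) :
    volume.real (Metric.ball (0 : F) ρ) * Real.exp (⟪x, p⟫ - ρ * ‖x‖) ≤ laplace K x := by
  have hlow : ∀ y ∈ Metric.ball p ρ, Real.exp (⟪x, p⟫ - ρ * ‖x‖) ≤ Real.exp ⟪x, y⟫ := by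
    intro y hy
    have hinner : -(‖x‖ * ‖y - p‖) ≤ ⟪x, y⟫ - ⟪x, p⟫ := by
      rw [← inner_sub_right]
      exact (abs_le.1 (abs_real_inner_le_norm x (y - p))).1
    have hdist : ‖x‖ * ‖y - p‖ ≤ ‖x‖ * ρ := by
      gcongr
      exact (mem_ball_iff_norm.1 hy).le
    exact Real.exp_le_exp.2 (by linarith)
  calc volume.real (Metric.ball (0 : F) ρ) * Real.exp (⟪x, p⟫ - ρ * ‖x‖)
      = ∫ _ in Metric.ball p ρ, Real.exp (⟪x, p⟫ - ρ * ‖x‖) := by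
        rw [setIntegral_const, smul_eq_mul, Measure.real, Measure.real,
          Measure.addHaar_ball_center volume p]
    _ ≤ ∫ y in Metric.ball p ρ, Real.exp ⟪x, y⟫ :=
        setIntegral_mono_on (integrableOn_const measure_ball_lt_top.ne)
          ((integrable_exp_inner hK.isCompact x).mono_set hball) measurableSet_ball hlow
    _ ≤ laplace K x := setIntegral_mono_set (integrable_exp_inner hK.isCompact x)
        (Eventually.of_forall fun y => (Real.exp_pos _).le) hball.eventuallyLE

lemma exists_le_log_laplace_sub_inner {a : F} (ha : a ∈ interior K) :
    ∃ c, ∃ r > 0, ∀ x, c + r * ‖x‖ ≤ Real.log (laplace K x) - ⟪x, a⟫ := by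
  obtain ⟨r, hr, hball⟩ := Metric.isOpen_iff.1 isOpen_interior a ha
  set ρ := r / 4 with hρ
  have hvol : 0 < volume.real (Metric.ball (0 : F) ρ) :=
    ENNReal.toReal_pos (Metric.measure_ball_pos _ _ (by positivity)).ne' measure_ball_lt_top.ne
  refine ⟨Real.log (volume.real (Metric.ball (0 : F) ρ)), ρ, by positivity, fun x => ?_⟩
  have hnorm : ‖‖x‖⁻¹ • x‖ ≤ 1 := by
    rw [norm_smul, norm_inv, norm_norm]
    exact inv_mul_le_one
  have hsub : Metric.ball (a + (2 * ρ) • ‖x‖⁻¹ • x) ρ ⊆ K := by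
    refine (Metric.ball_subset_ball' ?_).trans (hball.trans interior_subset)
    rw [dist_self_add_left, norm_smul, Real.norm_of_nonneg (by positivity)]
    nlinarith
  have hinner : ⟪x, ‖x‖⁻¹ • x⟫ = ‖x‖ := by
    rw [inner_smul_right, real_inner_self_eq_norm_sq, sq, mul_comm, mul_self_mul_inv]
  have hlog := Real.log_le_log (by positivity) (le_laplace_of_ball_subset hK x hsub)
  rw [Real.log_mul hvol.ne' (Real.exp_pos _).ne', Real.log_exp, inner_add_right, inner_smul_right,
    hinner] at hlog
  linarith

end LogLaplace

/-! ### The volume of `s • K + L` is a polynomial in `s` -/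

section VolumePolynomial

open scoped RealInnerProductSpace
open Polynomial

lemma IsSolidBody.smul_add {F : Type*} [NormedAddCommGroup F] [NormedSpace ℝ F] {K L : Set F}
    (hK : IsSolidBody K) (hL : IsSolidBody L) (s : ℝ) : IsSolidBody (s • K + L) := by
  refine ⟨(hK.isCompact.smul s).add hL.isCompact, (hK.convex.smul s).add hL.convex, ?_⟩
  have hsub : s • K + interior L ⊆ interior (s • K + L) :=
    interior_maximal (add_subset_add_left interior_subset) isOpen_interior.add_left
  exact (hK.nonempty.smul_set.add hL.interior_nonempty).mono hsub

lemma IsSolidBody.interior_smul_add_subset {F : Type*} [NormedAddCommGroup F] [NormedSpace ℝ F]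
    {K L : Set F} (hK : IsSolidBody K) (hL : IsSolidBody L) (s : ℝ) :
    interior (s • K + L) ⊆ s • interior K + interior L := by
  have hopen : IsOpen (s • interior K + interior L) := isOpen_interior.add_left
  have hconvex : Convex ℝ (s • interior K + interior L) :=
    (hK.convex.interior.smul s).add hL.convex.interior
  have hclosure : s • K + L ⊆ closure (s • interior K + interior L) := by
    rintro _ ⟨_, ⟨a, ha, rfl⟩, b, hb, rfl⟩
    exact map_mem_closure₂ (f := fun a b => s • a + b) (by fun_prop)
      (hK.subset_closure_interior ha) (hL.subset_closure_interior hb)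
      fun a ha b hb => add_mem_add (smul_mem_smul_set ha) hb
  calc interior (s • K + L) ⊆ interior (closure (s • interior K + interior L)) :=
        interior_mono hclosure
    _ = s • interior K + interior L := by
        rw [hconvex.interior_closure_eq_interior_of_nonempty_interior, hopen.interior_eq]
        rw [hopen.interior_eq]
        exact hK.interior_nonempty.smul_set.add hL.interior_nonempty

section Gradient

variable {F : Type*} [NormedAddCommGroup F] [InnerProductSpace ℝ F]

/-- `T` is the gradient and `A` the Hessian of a strictly convex potential `ψ`, and the growth of
`ψ` is that of the support function of `K`. Such a `T` is a diffeomorphism between the whole space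
and the body `K`, up to the boundary of `K`. -/
structure IsStrictlyConvexGradient (T : F → F) (A : F → F →L[ℝ] F) (ψ : F → ℝ) (K : Set F) :
    Prop where
  hasFDerivAt : ∀ x, HasFDerivAt T (A x) x
  hasFDerivAt_potential : ∀ x, HasFDerivAt ψ (innerSL ℝ (T x)) x
  isSymmetric : ∀ x, (A x : F →ₗ[ℝ] F).IsSymmetric
  inner_pos : ∀ x v, v ≠ 0 → 0 < ⟪A x v, v⟫
  mem : ∀ x, T x ∈ K
  coercive : ∀ a ∈ interior K, ∃ c, ∃ r > 0, ∀ x, c + r * ‖x‖ ≤ ψ x - ⟪x, a⟫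

lemma isStrictlyConvexGradient_tiltedMean [FiniteDimensional ℝ F] [MeasurableSpace F]
    [BorelSpace F] {K : Set F} (hK : IsSolidBody K) :
    IsStrictlyConvexGradient (tiltedMean K) (tiltedCovariance K)
      (fun x => Real.log (laplace K x)) K where
  hasFDerivAt := hasFDerivAt_tiltedMean hK
  hasFDerivAt_potential := hasFDerivAt_log_laplace hK
  isSymmetric _ := ProbabilityTheory.isPositive_covarianceOperator.isSymmetric
  inner_pos x _ hv := inner_tiltedCovariance_pos hK x hv
  mem := tiltedMean_mem hK
  coercive _ ha := exists_le_log_laplace_sub_inner hK ha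

namespace IsStrictlyConvexGradient

variable {T T' : F → F} {A B : F → F →L[ℝ] F} {ψ ψ' : F → ℝ} {K L : Set F}

lemma smul_add (h : IsStrictlyConvexGradient T A ψ K) (h' : IsStrictlyConvexGradient T' B ψ' L)
    (hK : IsSolidBody K) (hL : IsSolidBody L) {s : ℝ} (hs : 0 ≤ s) :
    IsStrictlyConvexGradient (s • T + T') (s • A + B) (s • ψ + ψ') (s • K + L) where
  hasFDerivAt x := ((h.hasFDerivAt x).const_smul s).add (h'.hasFDerivAt x)
  hasFDerivAt_potential x := by
    simpa using ((h.hasFDerivAt_potential x).const_smul s).add (h'.hasFDerivAt_potential x)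
  isSymmetric x := ((h.isSymmetric x).smul (by simp)).add (h'.isSymmetric x)
  inner_pos x v hv := by
    have hA := mul_nonneg hs (h.inner_pos x v hv).le
    have hB := h'.inner_pos x v hv
    simp only [Pi.add_apply, Pi.smul_apply, add_apply, smul_apply, inner_add_left,
      real_inner_smul_left]
    linarith
  mem x := add_mem_add (smul_mem_smul_set (h.mem x)) (h'.mem x)
  coercive a ha := by
    obtain ⟨_, ⟨k, hk, rfl⟩, l, hl, rfl⟩ := hK.interior_smul_add_subset hL s ha
    obtain ⟨c, r, hr, hψ⟩ := h.coercive k hk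
    obtain ⟨c', r', hr', hψ'⟩ := h'.coercive l hl
    refine ⟨s * c + c', s * r + r', by positivity, fun x => ?_⟩
    have hsψ := mul_le_mul_of_nonneg_left (hψ x) hs
    simp only [Pi.add_apply, Pi.smul_apply, smul_eq_mul, inner_add_right, real_inner_smul_right]
    linarith [hψ' x]

lemma injective (h : IsStrictlyConvexGradient T A ψ K) : Function.Injective T := by
  intro x x' hT
  by_contra hne
  have hv : x' - x ≠ 0 := sub_ne_zero.2 (Ne.symm hne)
  have hderiv (r : ℝ) : HasDerivAt (fun r : ℝ => ⟪T (x + r • (x' - x)), x' - x⟫)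
      ⟪A (x + r • (x' - x)) (x' - x), x' - x⟫ r := by
    have hline : HasDerivAt (fun r : ℝ => x + r • (x' - x)) (x' - x) r := by
      simpa using ((hasDerivAt_id r).smul_const (x' - x)).const_add x
    simpa using ((h.hasFDerivAt _).comp_hasDerivAt r hline).inner ℝ (hasDerivAt_const r (x' - x))
  have hmono : StrictMono fun r : ℝ => ⟪T (x + r • (x' - x)), x' - x⟫ :=
    strictMono_of_deriv_pos fun r => by rw [(hderiv r).deriv]; exact h.inner_pos _ _ hv
  have hlt := hmono (zero_lt_one' ℝ)
  simp only [zero_smul, add_zero, one_smul, add_sub_cancel, hT] at hlt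
  exact lt_irrefl _ hlt

variable [FiniteDimensional ℝ F]

lemma interior_subset_range (h : IsStrictlyConvexGradient T A ψ K) : interior K ⊆ range T := by
  intro a ha
  obtain ⟨c, r, hr, hψ⟩ := h.coercive a ha
  have hderiv (x : F) : HasFDerivAt (fun x => ψ x - ⟪x, a⟫) (innerSL ℝ (T x) - innerSL ℝ a) x :=
    (h.hasFDerivAt_potential x).sub (hasFDerivAt_inner_left a x)
  have hlim : Tendsto (fun x => ψ x - ⟪x, a⟫) (cocompact F) atTop :=
    tendsto_atTop_mono hψ
      (tendsto_atTop_add_const_left _ _ (tendsto_norm_cocompact_atTop.const_mul_atTop hr))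
  have hcont : Continuous fun x => ψ x - ⟪x, a⟫ :=
    continuous_iff_continuousAt.2 fun x => (hderiv x).continuousAt
  obtain ⟨x, hx⟩ := hcont.exists_forall_le hlim
  have hzero := (isMinOn_univ_iff.2 hx |>.isLocalMin univ_mem).hasFDerivAt_eq_zero (hderiv x)
  exact ⟨x, ext_inner_right ℝ fun v => DFunLike.congr_fun (sub_eq_zero.1 hzero) v⟩

lemma det_nonneg (h : IsStrictlyConvexGradient T A ψ K) (x : F) : 0 ≤ (A x).det := by
  have hpos : (A x : F →ₗ[ℝ] F).IsPositive := by
    refine ⟨h.isSymmetric x, fun v => ?_⟩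
    rcases eq_or_ne v 0 with rfl | hv
    · simp
    · exact (h.inner_pos x v hv).le
  have hdet := ((LinearMap.posSemidef_toMatrix_iff (stdOrthonormalBasis ℝ F)).2 hpos).det_nonneg
  rwa [LinearMap.det_toMatrix] at hdet

variable [MeasurableSpace F] [BorelSpace F]

lemma measurable_det (h : IsStrictlyConvexGradient T A ψ K) : Measurable fun x => (A x).det := by
  have hA : A = fderiv ℝ T := funext fun x => (h.hasFDerivAt x).fderiv.symm
  exact ContinuousLinearMap.continuous_det.measurable.comp (hA ▸ measurable_fderiv ℝ T)

lemma lintegral_det_eq_volume (h : IsStrictlyConvexGradient T A ψ K) (hK : Convex ℝ K) :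
    ∫⁻ x, ENNReal.ofReal (A x).det = volume K := by
  have himage : ∫⁻ x, ENNReal.ofReal (A x).det = volume (range T) := by
    rw [← image_univ, ← lintegral_abs_det_fderiv_eq_addHaar_image volume MeasurableSet.univ
      (fun x _ => (h.hasFDerivAt x).hasFDerivWithinAt) h.injective.injOn, setLIntegral_univ]
    simp only [abs_of_nonneg (h.det_nonneg _)]
  have hinterior : volume (interior K) = volume K :=
    measure_congr (interior_ae_eq_of_null_frontier (hK.addHaar_frontier volume))
  rw [himage]
  exact le_antisymm (measure_mono (range_subset_iff.2 h.mem))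
    (hinterior ▸ measure_mono h.interior_subset_range)

lemma integrable_det (h : IsStrictlyConvexGradient T A ψ K) (hK : IsSolidBody K) :
    Integrable fun x => (A x).det := by
  refine ⟨h.measurable_det.aestronglyMeasurable, ?_⟩
  rw [hasFiniteIntegral_iff_ofReal (Eventually.of_forall h.det_nonneg),
    h.lintegral_det_eq_volume hK.convex]
  exact hK.isCompact.measure_lt_top

lemma integral_det_eq_volume (h : IsStrictlyConvexGradient T A ψ K) (hK : Convex ℝ K) :
    ∫ x, (A x).det = volume.real K := by
  rw [integral_eq_lintegral_of_nonneg_ae (Eventually.of_forall h.det_nonneg)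
    h.measurable_det.aestronglyMeasurable, h.lintegral_det_eq_volume hK, Measure.real]

end IsStrictlyConvexGradient

end Gradient

lemma exists_polynomial_eval_eq_det {F : Type*} [NormedAddCommGroup F] [NormedSpace ℝ F]
    [FiniteDimensional ℝ F] (A B : F →L[ℝ] F) :
    ∃ p : ℝ[X], p.degree < ↑(Module.finrank ℝ F + 1) ∧ ∀ s, p.eval s = (s • A + B).det := by
  let b := Module.finBasis ℝ F
  let a' := LinearMap.toMatrix b b (A : F →ₗ[ℝ] F)
  let b' := LinearMap.toMatrix b b (B : F →ₗ[ℝ] F)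
  refine ⟨((X : ℝ[X]) • a'.map C + b'.map C).det, ?_, fun s => ?_⟩
  · refine degree_le_natDegree.trans_lt (Nat.cast_lt.2 (Nat.lt_succ_of_le ?_))
    simpa using natDegree_det_X_add_C_le a' b'
  · have h : (s • A + B).det = (s • a' + b').det := by
      rw [ContinuousLinearMap.det, ← LinearMap.det_toMatrix b]
      simp [a', b']
    rw [h, ← coe_evalRingHom, RingHom.map_det]
    congr 1
    ext i j
    simp
    ring

lemma exists_polynomial_integral_eq {α : Type*} [MeasurableSpace α] {μ : Measure α} {d : ℕ}
    {f : ℝ → α → ℝ} {S : Set ℝ} (hS : ∀ i < d, (i : ℝ) ∈ S) (hf : ∀ s ∈ S, Integrable (f s) μ)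
    (hp : ∀ x, ∃ p : ℝ[X], p.degree < d ∧ ∀ s, p.eval s = f s x) :
    ∃ P : ℝ[X], P.degree < d ∧ ∀ s, P.eval s = ∫ x, f s x ∂μ := by
  have hinj : Set.InjOn (fun i : ℕ => (i : ℝ)) (Finset.range d) := Nat.cast_injective.injOn
  let P := Lagrange.interpolate (Finset.range d) (fun i : ℕ => (i : ℝ))
  have hinterpolate (s x) : f s x = ∑ i ∈ Finset.range d,
      f i x * (Lagrange.basis (Finset.range d) (fun i : ℕ => (i : ℝ)) i).eval s := by
    obtain ⟨p, hdeg, heval⟩ := hp x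
    have h := congrArg (eval s)
      (Lagrange.eq_interpolate hinj (hdeg.trans_eq (by rw [Finset.card_range])))
    simpa only [Lagrange.interpolate_apply, eval_finsetSum, eval_mul, eval_C, heval] using h
  refine ⟨P fun i => ∫ x, f i x ∂μ, ?_, fun s => ?_⟩
  · exact (Lagrange.degree_interpolate_lt _ hinj).trans_eq (by rw [Finset.card_range])
  · simp only [hinterpolate s, P, Lagrange.interpolate_apply, eval_finsetSum, eval_mul, eval_C]
    rw [integral_finsetSum _ fun (i : ℕ) hi => (hf i (hS i (Finset.mem_range.1 hi))).mul_const _]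
    simp only [integral_mul_const]

theorem exists_polynomial_volume_smul_add {F : Type*} [NormedAddCommGroup F]
    [InnerProductSpace ℝ F] [FiniteDimensional ℝ F] [MeasurableSpace F] [BorelSpace F]
    {K L : Set F} (hK : IsSolidBody K) (hL : IsSolidBody L) :
    ∃ P : ℝ[X], P.natDegree ≤ Module.finrank ℝ F ∧
      ∀ s : ℝ, 0 ≤ s → volume.real (s • K + L) = P.eval s := by
  have h (s : ℝ) (hs : 0 ≤ s) := (isStrictlyConvexGradient_tiltedMean hK).smul_add
    (isStrictlyConvexGradient_tiltedMean hL) hK hL hs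
  obtain ⟨P, hdeg, hP⟩ := exists_polynomial_integral_eq (S := Ici 0) (μ := volume)
    (f := fun s x => (s • tiltedCovariance K x + tiltedCovariance L x).det)
    (fun i _ => mem_Ici.2 i.cast_nonneg) (fun s hs => (h s hs).integrable_det (hK.smul_add hL s))
    fun x => exists_polynomial_eval_eq_det _ _
  refine ⟨P, natDegree_le_iff_coeff_eq_zero.2 ((degree_lt_iff_coeff_zero _ _).1 hdeg),
    fun s hs => ?_⟩
  rw [hP, ← (h s hs).integral_det_eq_volume (hK.smul_add hL s).convex]
  rfl

end VolumePolynomial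

/-! ### Mixed volumes and Minkowski's first inequality -/

section MixedVolume

open Polynomial

lemma sum_powerset_fin_succ {M : Type*} [AddCommMonoid M] (m : ℕ) (f : Finset (Fin (m + 1)) → M)
    (a b : ℕ → M) (ha : ∀ S, Fin.last m ∉ S → f S = a S.card)
    (hb : ∀ S, Fin.last m ∉ S → f (insert (Fin.last m) S) = b S.card) :
    ∑ S, f S = ∑ k ∈ Finset.range (m + 1), m.choose k • (a k + b k) := by
  set s : Finset (Fin (m + 1)) := Finset.univ.map Fin.castSuccEmb with hs
  have hlast : Fin.last m ∉ s := by simp [hs]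
  have huniv : (Finset.univ : Finset (Finset (Fin (m + 1)))) =
      (insert (Fin.last m) s).powerset := by
    rw [← Finset.powerset_univ, Fin.univ_castSuccEmb, Finset.cons_eq_insert]
  have hcard : s.card = m := by simp [hs]
  have hnot : ∀ t ∈ s.powerset, Fin.last m ∉ t := fun t ht h => hlast (Finset.mem_powerset.1 ht h)
  rw [huniv, Finset.sum_powerset_insert hlast,
    Finset.sum_congr rfl fun t ht => ha t (hnot t ht),
    Finset.sum_congr rfl fun t ht => hb t (hnot t ht), Finset.sum_powerset_apply_card,
    Finset.sum_powerset_apply_card, hcard, ← Finset.sum_add_distrib]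
  simp only [smul_add]

lemma sum_choose_mul_eval {R : ℝ[X]} {m : ℕ} (hR : R.natDegree ≤ m) :
    ∑ k ∈ Finset.range (m + 1), (-1 : ℝ) ^ (m - k) * m.choose k * R.eval (k : ℝ) =
      m.factorial * R.coeff m := by
  have h : (fwdDiff (1 : ℝ))^[m] (fun x => R.eval x) 0 = m.factorial * R.coeff m := by
    rcases hR.eq_or_lt with rfl | h
    · rw [fwdDiff_iter_degree_eq_factorial]
      simp [mul_comm]
    · rw [fwdDiff_iter_eq_zero_of_degree_lt h, coeff_eq_zero_of_natDegree_lt h, Pi.zero_apply,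
        mul_zero]
  rw [← h, fwdDiff_iter_eq_sum_shift]
  exact Finset.sum_congr rfl fun k _ => by simp

lemma mul_pow_mul_sub_le_coeff_one {Q : ℝ[X]} {m : ℕ} {a b : ℝ} (h0 : Q.eval 0 = a ^ (m + 1))
    (hQ : ∀ t ∈ Ioo (0 : ℝ) 1, ((1 - t) * a + t * b) ^ (m + 1) ≤ Q.eval t) :
    (m + 1) * a ^ m * (b - a) ≤ Q.coeff 1 := by
  have hpoly : HasDerivAt (fun t => Q.eval t) (Q.coeff 1) 0 := by
    simpa [← coeff_zero_eq_eval_zero, coeff_derivative] using Q.hasDerivAt 0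
  have hline : HasDerivAt (fun t : ℝ => (1 - t) * a + t * b) (b - a) 0 :=
    ((((hasDerivAt_id (0 : ℝ)).const_sub 1).mul_const a).add
      ((hasDerivAt_id (0 : ℝ)).mul_const b)).congr_deriv (by ring)
  have hdiff : HasDerivAt (fun t => Q.eval t - ((1 - t) * a + t * b) ^ (m + 1))
      (Q.coeff 1 - (m + 1) * a ^ m * (b - a)) 0 :=
    (hpoly.sub (hline.pow (m + 1))).congr_deriv (by simp)
  rw [← sub_nonneg]
  refine ge_of_tendsto hdiff.tendsto_slope_zero_right ?_
  filter_upwards [Ioo_mem_nhdsGT (zero_lt_one' ℝ)] with t ht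
  have hle := hQ t ht
  have hpos := ht.1
  simp only [zero_add, h0, sub_zero, one_mul, zero_mul, add_zero, sub_self, smul_eq_mul]
  exact mul_nonneg (by positivity) (by linarith)

lemma coe_nsmul_convexBody {V : Type*} [NormedAddCommGroup V] [NormedSpace ℝ V] (k : ℕ)
    (K : ConvexBody V) : ((k • K : ConvexBody V) : Set V) = (k : ℝ) • (K : Set V) := by
  induction k with
  | zero => simp [Set.zero_smul_set K.nonempty]
  | succ k ih =>
    rw [succ_nsmul, ConvexBody.coe_add, ih, Nat.cast_succ,
      K.convex.add_smul (Nat.cast_nonneg k) zero_le_one, one_smul]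

lemma IsSolidBody.add {V : Type*} [NormedAddCommGroup V] [NormedSpace ℝ V] {K L : Set V}
    (hK : IsSolidBody K) (hL : IsSolidBody L) : IsSolidBody (K + L) :=
  ⟨hK.isCompact.add hL.isCompact, hK.convex.add hL.convex,
    (hK.interior_nonempty.add hL.interior_nonempty).mono subset_interior_add⟩

lemma IsSolidBody.exists_measureReal_eq_pow {V : Type*} [NormedAddCommGroup V] [NormedSpace ℝ V]
    [MeasurableSpace V] {K : Set V} (hK : IsSolidBody K) (μ : Measure V) [μ.IsOpenPosMeasure]
    [IsFiniteMeasureOnCompacts μ] {d : ℕ} (hd : d ≠ 0) : ∃ a, 0 < a ∧ μ.real K = a ^ d :=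
  ⟨μ.real K ^ (d : ℝ)⁻¹, Real.rpow_pos_of_pos (hK.measureReal_pos μ) _,
    (Real.rpow_inv_natCast_pow measureReal_nonneg hd).symm⟩

lemma rpow_div_succ_pow_succ {a : ℝ} (ha : 0 ≤ a) (m : ℕ) :
    (a ^ (m + 1)) ^ (m / (m + 1) : ℝ) = a ^ m := by
  rw [← Real.rpow_natCast_mul ha, Nat.cast_succ, mul_div_cancel₀ _ (by positivity),
    Real.rpow_natCast]

lemma rpow_one_div_succ_pow_succ {a : ℝ} (ha : 0 ≤ a) (m : ℕ) :
    (a ^ (m + 1)) ^ (1 / (m + 1) : ℝ) = a := by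
  rw [← Real.rpow_natCast_mul ha, Nat.cast_succ, mul_div_cancel₀ _ (by positivity), Real.rpow_one]

lemma isSolidBody_coe {V : Type*} [NormedAddCommGroup V] [NormedSpace ℝ V] {K : ConvexBody V}
    (hK : (interior (K : Set V)).Nonempty) : IsSolidBody (K : Set V) :=
  ⟨K.isCompact, K.convex, hK⟩

variable {F : Type*} [NormedAddCommGroup F] [InnerProductSpace ℝ F] [FiniteDimensional ℝ F]
  [MeasurableSpace F] [BorelSpace F]

/-- The mixed volume `V(K, …, K, L)` of `j - 1` copies of `K` and one copy of `L`, in the indexing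
of `Phi₁`. -/
def mixedVolumePair (j : ℕ) (K L : ConvexBody F) : ℝ :=
  mixedVolume fun i : Fin j => if (i : ℕ) + 1 = j then L else K

variable {m : ℕ} {K L : ConvexBody F}

lemma mixedVolumePair_eq_sum (m : ℕ) (K L : ConvexBody F) :
    mixedVolumePair (m + 1) K L = ((m + 1).factorial : ℝ)⁻¹ * ∑ k ∈ Finset.range (m + 1),
      (-1 : ℝ) ^ (m - k) * m.choose k *
        (volume.real ((k : ℝ) • (K : Set F) + (L : Set F)) -
          volume.real ((k : ℝ) • (K : Set F))) := by
  rw [mixedVolumePair, mixedVolume]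
  congr 1
  have hsum (S : Finset (Fin (m + 1))) (hS : Fin.last m ∉ S) :
      (∑ i ∈ S, if (i : ℕ) + 1 = m + 1 then L else K) = S.card • K := by
    rw [← Finset.sum_const]
    refine Finset.sum_congr rfl fun i hi => if_neg fun h => hS ?_
    exact (Fin.ext (Nat.succ_injective h) : i = Fin.last m) ▸ hi
  have hcard (S : Finset (Fin (m + 1))) (hS : Fin.last m ∉ S) : S.card ≤ m := by
    have := Finset.card_le_univ (insert (Fin.last m) S)
    rwa [Finset.card_insert_of_notMem hS, Fintype.card_fin, Nat.add_le_add_iff_right] at this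
  rw [sum_powerset_fin_succ m _
    (fun k => -((-1 : ℝ) ^ (m - k) * volume.real ((k : ℝ) • (K : Set F))))
    (fun k => (-1 : ℝ) ^ (m - k) * volume.real ((k : ℝ) • (K : Set F) + (L : Set F)))]
  · refine Finset.sum_congr rfl fun k _ => ?_
    rw [nsmul_eq_mul]
    ring
  · intro S hS
    rw [hsum S hS, coe_nsmul_convexBody, Nat.sub_add_comm (hcard S hS), pow_succ]
    ring
  · intro S hS
    rw [Finset.sum_insert hS, hsum S hS, if_pos (by simp), add_comm L, ConvexBody.coe_add,
      coe_nsmul_convexBody, Finset.card_insert_of_notMem hS, Nat.add_sub_add_right]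

lemma mixedVolumePair_one (K L : ConvexBody F) (hd : Module.finrank ℝ F = 1) :
    mixedVolumePair 1 K L = volume.real (L : Set F) := by
  rw [mixedVolumePair_eq_sum 0]
  simp [measureReal_smul_of_nonneg, hd, Set.zero_smul_set K.nonempty]

section FinrankSucc

variable (hd : Module.finrank ℝ F = m + 1)
include hd

lemma mixedVolumePair_eq_coeff {P : ℝ[X]} (hP : P.natDegree ≤ m + 1)
    (htop : P.coeff (m + 1) = volume.real (K : Set F))
    (hval : ∀ k : ℕ, volume.real ((k : ℝ) • (K : Set F) + (L : Set F)) = P.eval (k : ℝ)) :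
    mixedVolumePair (m + 1) K L = P.coeff m / (m + 1) := by
  let R : ℝ[X] := P - C (volume.real (K : Set F)) * X ^ (m + 1)
  have hR : R.natDegree ≤ m := by
    rw [natDegree_le_iff_coeff_eq_zero]
    intro i hi
    rw [coeff_sub, coeff_C_mul_X_pow]
    rcases (Nat.succ_le_of_lt hi).eq_or_lt with rfl | h
    · rw [if_pos rfl, htop, sub_self]
    · rw [if_neg (by lia), coeff_eq_zero_of_natDegree_lt (by lia), sub_zero]
  have hRm : R.coeff m = P.coeff m := by
    rw [coeff_sub, coeff_C_mul_X_pow, if_neg (by lia), sub_zero]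
  have hReval (k : ℕ) : volume.real ((k : ℝ) • (K : Set F) + (L : Set F)) -
      volume.real ((k : ℝ) • (K : Set F)) = R.eval (k : ℝ) := by
    rw [hval, measureReal_smul_of_nonneg volume k.cast_nonneg, hd]
    simp only [R, eval_sub, eval_mul, eval_C, eval_pow, eval_X, mul_comm]
  simp only [mixedVolumePair_eq_sum, hReval]
  rw [sum_choose_mul_eval hR, hRm, Nat.factorial_succ, Nat.cast_mul, mul_inv, mul_assoc,
    inv_mul_cancel_left₀ (Nat.cast_ne_zero.2 m.factorial_ne_zero), Nat.cast_succ, inv_mul_eq_div]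

lemma mixedVolumePair_of_homothetic {c : ℝ} (hc : 0 < c) {t : F}
    (h : (L : Set F) = c • (K : Set F) + {t}) :
    mixedVolumePair (m + 1) K L = c * volume.real (K : Set F) := by
  have hdeg : ((X + C c) ^ (m + 1) : ℝ[X]).natDegree = m + 1 := by
    rw [natDegree_pow, natDegree_X_add_C, mul_one]
  rw [mixedVolumePair_eq_coeff hd (P := C (volume.real (K : Set F)) * (X + C c) ^ (m + 1))]
  · rw [coeff_C_mul, coeff_X_add_C_pow, Nat.add_sub_cancel_left, pow_one,
      Nat.choose_succ_self_right]
    push_cast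
    field_simp
  · exact (natDegree_C_mul_le _ _).trans hdeg.le
  · rw [coeff_C_mul, coeff_X_add_C_pow, Nat.sub_self, pow_zero, Nat.choose_self, Nat.cast_one,
      mul_one, mul_one]
  · intro k
    rw [h, ← add_assoc, ← K.convex.add_smul k.cast_nonneg hc.le, add_singleton,
      Measure.real, image_add_right, measure_preimage_add_right,
      ← Measure.real, measureReal_smul_of_nonneg volume (by positivity), hd]
    simp [mul_comm]

variable (hK : IsSolidBody (K : Set F)) (hL : IsSolidBody (L : Set F))
include hK hL

lemma exists_polynomial_mixedVolumePair :
    ∃ Q : ℝ[X], (∀ s : ℝ, 0 ≤ s → volume.real (s • (L : Set F) + (K : Set F)) = Q.eval s) ∧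
      mixedVolumePair (m + 1) K L = Q.coeff 1 / (m + 1) := by
  obtain ⟨P, hP, hPval⟩ := exists_polynomial_volume_smul_add hK hL
  obtain ⟨Q, hQ, hQval⟩ := exists_polynomial_volume_smul_add hL hK
  rw [hd] at hP hQ
  have hset {s : ℝ} (hs : 0 < s) : s • (K : Set F) + L = s • (s⁻¹ • (L : Set F) + K) := by
    rw [smul_add, smul_smul, mul_inv_cancel₀ hs.ne', one_smul, add_comm]
  have hreflect : P = reflect (m + 1) Q := by
    refine eq_of_infinite_eval_eq _ _ ((Ioi_infinite (0 : ℝ)).mono fun s (hs : 0 < s) => ?_)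
    let : Invertible s⁻¹ := invertibleOfNonzero (inv_ne_zero hs.ne')
    have h := eval₂_reflect_mul_pow (RingHom.id ℝ) s⁻¹ (m + 1) Q hQ
    rw [invOf_eq_inv, inv_inv] at h
    change eval s (reflect (m + 1) Q) * s⁻¹ ^ (m + 1) = eval s⁻¹ Q at h
    change eval s P = eval s (reflect (m + 1) Q)
    rw [← hPval s hs.le, hset hs, measureReal_smul_of_nonneg volume hs.le,
      hQval _ (by positivity), hd, ← h, inv_pow]
    field_simp
  refine ⟨Q, hQval, ?_⟩
  rw [mixedVolumePair_eq_coeff hd hP _ fun k => hPval k k.cast_nonneg]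
  · rw [hreflect, coeff_reflect, revAt_le (by lia), Nat.add_sub_cancel_left]
  · rw [hreflect, coeff_reflect, revAt_le le_rfl, Nat.sub_self, coeff_zero_eq_eval_zero,
      ← hQval 0 le_rfl, Set.zero_smul_set L.nonempty, zero_add]

variable {k l : ℝ} (hk : 0 < k) (hKk : volume.real (K : Set F) = k ^ (m + 1))
include hk hKk

/-- Brunn–Minkowski along the segment from `K` to `K + L` bounds the derivative of
`t ↦ vol (K + t L)` at `0`. -/
lemma pow_mul_sub_le_mixedVolumePair {a : ℝ} (ha : 0 < a)
    (hKLa : volume.real ((K : Set F) + (L : Set F)) = a ^ (m + 1)) :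
    k ^ m * (a - k) ≤ mixedVolumePair (m + 1) K L := by
  obtain ⟨Q, hQ, hV⟩ := exists_polynomial_mixedVolumePair hd hK hL
  have hle : ∀ t ∈ Ioo (0 : ℝ) 1, ((1 - t) * k + t * a) ^ (m + 1) ≤ Q.eval t := by
    intro t ⟨ht0, ht1⟩
    have ht : 0 < 1 - t := sub_pos.2 ht1
    have hset : (1 - t) • (K : Set F) + t • ((K : Set F) + L) = t • (L : Set F) + K := by
      rw [smul_add, ← add_assoc, ← K.convex.add_smul ht.le ht0.le, sub_add_cancel, one_smul,
        add_comm]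
    have h := brunnMinkowski volume (hK.smul ht.ne') ((hK.add hL).smul ht0.ne') (mul_pos ht hk)
      (mul_pos ht0 ha) (by rw [measureReal_smul_of_nonneg volume ht.le, hKk, hd, mul_pow])
      (by rw [measureReal_smul_of_nonneg volume ht0.le, hKLa, hd, mul_pow])
    rwa [hset, hQ t ht0.le, hd] at h
  have hQ0 : Q.eval 0 = k ^ (m + 1) := by
    rw [← hQ 0 le_rfl, Set.zero_smul_set L.nonempty, zero_add, hKk]
  rw [hV, le_div_iff₀ (by positivity)]
  linarith [mul_pow_mul_sub_le_coeff_one hQ0 hle]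

variable (hl : 0 < l) (hLl : volume.real (L : Set F) = l ^ (m + 1))
include hl hLl

theorem minkowski_first : k ^ m * l ≤ mixedVolumePair (m + 1) K L := by
  obtain ⟨a, ha, hKLa⟩ := (hK.add hL).exists_measureReal_eq_pow volume m.succ_ne_zero
  have hBM := brunnMinkowski volume hK hL hk hl (by rw [hd, hKk]) (by rw [hd, hLl])
  rw [hKLa, hd, pow_le_pow_iff_left₀ (by positivity) ha.le m.succ_ne_zero] at hBM
  calc k ^ m * l ≤ k ^ m * (a - k) := by gcongr; linarith
    _ ≤ mixedVolumePair (m + 1) K L := pow_mul_sub_le_mixedVolumePair hd hK hL hk hKk ha hKLa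

theorem exists_suppFn_div_eq_of_minkowski_first_eq
    (h : mixedVolumePair (m + 1) K L ≤ k ^ m * l) :
    ∃ t : F, ∀ u : F →L[ℝ] ℝ, suppFn (K : Set F) u / k = suppFn (L : Set F) u / l + u t := by
  obtain ⟨a, ha, hKLa⟩ := (hK.add hL).exists_measureReal_eq_pow volume m.succ_ne_zero
  have hle : a - k ≤ l := le_of_mul_le_mul_left
    ((pow_mul_sub_le_mixedVolumePair hd hK hL hk hKk ha hKLa).trans h) (by positivity)
  refine exists_suppFn_div_eq_of_brunnMinkowski_eq volume hK hL hk hl (by rw [hd, hKk])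
    (by rw [hd, hLl]) ?_
  rw [hd, hKLa]
  exact pow_le_pow_left₀ ha.le (by linarith) _

end FinrankSucc

section Rpow

variable (hd : Module.finrank ℝ F = m + 1) (hK : IsSolidBody (K : Set F))
  (hL : IsSolidBody (L : Set F))
include hd hK hL

lemma rpow_mul_rpow_le_mixedVolumePair :
    volume.real (K : Set F) ^ (m / (m + 1) : ℝ) * volume.real (L : Set F) ^ (1 / (m + 1) : ℝ) ≤
      mixedVolumePair (m + 1) K L := by
  obtain ⟨k, hk, hKk⟩ := hK.exists_measureReal_eq_pow volume m.succ_ne_zero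
  obtain ⟨l, hl, hLl⟩ := hL.exists_measureReal_eq_pow volume m.succ_ne_zero
  rw [hKk, hLl, rpow_div_succ_pow_succ hk.le, rpow_one_div_succ_pow_succ hl.le]
  exact minkowski_first hd hK hL hk hKk hl hLl

lemma exists_suppFn_eq_of_mixedVolumePair_le (h : mixedVolumePair (m + 1) K L ≤
    volume.real (K : Set F) ^ (m / (m + 1) : ℝ) * volume.real (L : Set F) ^ (1 / (m + 1) : ℝ)) :
    ∃ t : F, ∀ u : F →L[ℝ] ℝ, suppFn (K : Set F) u =
      (volume.real (K : Set F) / volume.real (L : Set F)) ^ (1 / (m + 1) : ℝ) *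
        suppFn (L : Set F) u + u t := by
  obtain ⟨k, hk, hKk⟩ := hK.exists_measureReal_eq_pow volume m.succ_ne_zero
  obtain ⟨l, hl, hLl⟩ := hL.exists_measureReal_eq_pow volume m.succ_ne_zero
  rw [hKk, hLl, rpow_div_succ_pow_succ hk.le, rpow_one_div_succ_pow_succ hl.le] at h
  obtain ⟨t, ht⟩ := exists_suppFn_div_eq_of_minkowski_first_eq hd hK hL hk hKk hl hLl h
  refine ⟨k • t, fun u => ?_⟩
  rw [hKk, hLl, ← div_pow, rpow_one_div_succ_pow_succ (by positivity), map_smul, smul_eq_mul,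
    ← div_mul_cancel₀ (suppFn (K : Set F) u) hk.ne', ht u]
  ring

end Rpow

end MixedVolume

/-! ### Linear images of convex bodies -/

section LinearImages

/-- The image of a convex body under a continuous linear map, as an additive homomorphism with
respect to Minkowski sums. -/
def mapBody {V F : Type*} [NormedAddCommGroup V] [NormedSpace ℝ V] [NormedAddCommGroup F]
    [NormedSpace ℝ F] (A : V →L[ℝ] F) : ConvexBody V →+ ConvexBody F where
  toFun K :=
    { carrier := A '' (K : Set V)
      convex' := K.convex.linear_image A.toLinearMap
      isCompact' := K.isCompact.image A.continuous
      nonempty' := K.nonempty.image _ }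
  map_zero' := ConvexBody.ext (by simp; rfl)
  map_add' K L := ConvexBody.ext (by simp [image_add])

lemma coe_mapBody {V F : Type*} [NormedAddCommGroup V] [NormedSpace ℝ V] [NormedAddCommGroup F]
    [NormedSpace ℝ F] (A : V →L[ℝ] F) (K : ConvexBody V) :
    (mapBody A K : Set F) = A '' (K : Set V) := rfl

/-- If `z` has distance `r > 0` from `C`, then the point at distance `δ` from `z` straight away
from `C` has distance `r + δ`. -/
lemma mem_of_closedBall_subset_thickening {F : Type*} [NormedAddCommGroup F]
    [InnerProductSpace ℝ F] [CompleteSpace F] {C : Set F} (hC : IsClosed C) (hconvex : Convex ℝ C)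
    {z : F} {δ : ℝ} (hδ : 0 ≤ δ) (h : Metric.closedBall z δ ⊆ Metric.thickening δ C) : z ∈ C := by
  have hne : C.Nonempty := by
    obtain ⟨x, hx, -⟩ := Metric.mem_thickening_iff.1 (h (Metric.mem_closedBall_self hδ))
    exact ⟨x, hx⟩
  obtain ⟨p, hp, hmin⟩ := exists_norm_eq_iInf_of_complete_convex hne hC.isComplete hconvex z
  have hobtuse := (norm_eq_iInf_iff_real_inner_le_zero hconvex hp).1 hmin
  by_contra hz
  have hr : 0 < ‖z - p‖ := norm_pos_iff.2 (sub_ne_zero.2 fun hzp => hz (hzp ▸ hp))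
  let v := (δ / ‖z - p‖) • (z - p)
  have hv : ‖v‖ = δ := by
    rw [norm_smul, Real.norm_of_nonneg (by positivity), div_mul_cancel₀ _ hr.ne']
  obtain ⟨x, hx, hdist⟩ := Metric.mem_thickening_iff.1 (h (a := z + v) (by simp [hv]))
  have hinner : inner ℝ (z - p) (z + v - x) =
      (‖z - p‖ + δ) * ‖z - p‖ - inner ℝ (z - p) (x - p) := by
    rw [show z + v - x = z - p + v - (x - p) by abel, inner_sub_right, inner_add_right,
      inner_smul_right, real_inner_self_eq_norm_sq]
    field_simp
  have hcauchy := real_inner_le_norm (z - p) (z + v - x)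
  rw [hinner, ← dist_eq_norm _ x] at hcauchy
  nlinarith [hobtuse x hx]

variable {Y V F : Type*} [TopologicalSpace Y] [NormedAddCommGroup V] [NormedSpace ℝ V]
  [NormedAddCommGroup F]

section NormedSpace

variable [NormedSpace ℝ F] {A : Y → V →L[ℝ] F} (hA : Continuous A) {M : Set V}
  (hM : IsCompact M) {y₀ : Y}
include hA hM

lemma eventually_notMem_image {z : F} (hz : z ∉ A y₀ '' M) : ∀ᶠ y in 𝓝 y₀, z ∉ A y '' M := by
  have happly : Continuous fun p : Y × V => A p.1 p.2 :=
    isBoundedBilinearMap_apply.continuous.comp ((hA.comp continuous_fst).prodMk continuous_snd)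
  have h : ∀ᶠ y in 𝓝 y₀, ∀ x ∈ M, A y x ≠ z :=
    hM.eventually_forall_of_forall_eventually fun x hx =>
      happly.continuousAt.eventually_ne fun hxz => hz ⟨x, hx, hxz⟩
  filter_upwards [h] with y hy
  rintro ⟨x, hx, hxz⟩
  exact hy x hx hxz

lemma eventually_image_subset_thickening {δ : ℝ} (hδ : 0 < δ) :
    ∀ᶠ y in 𝓝 y₀, A y '' M ⊆ Metric.thickening δ (A y₀ '' M) ∧
      A y₀ '' M ⊆ Metric.thickening δ (A y '' M) := by
  obtain ⟨R, hR, hMR⟩ := hM.isBounded.exists_pos_norm_le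
  filter_upwards [hA.continuousAt (Metric.ball_mem_nhds _ (div_pos hδ hR))] with y hy
  have hdist : ∀ x ∈ M, dist (A y x) (A y₀ x) < δ := fun x hx => by
    rw [mem_preimage, mem_ball_iff_norm] at hy
    rw [dist_eq_norm, ← sub_apply]
    calc ‖(A y - A y₀) x‖ ≤ ‖A y - A y₀‖ * R :=
          (A y - A y₀).le_opNorm_of_le (hMR x hx)
      _ < δ / R * R := by gcongr
      _ = δ := div_mul_cancel₀ _ hR.ne'
  constructor <;> rintro _ ⟨x, hx, rfl⟩
  · exact Metric.mem_thickening_iff.2 ⟨A y₀ x, ⟨x, hx, rfl⟩, hdist x hx⟩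
  · exact Metric.mem_thickening_iff.2 ⟨A y x, ⟨x, hx, rfl⟩, dist_comm (A y x) _ ▸ hdist x hx⟩

end NormedSpace

variable [InnerProductSpace ℝ F]

section Indicator

variable [CompleteSpace F] {A : Y → V →L[ℝ] F} (hA : Continuous A) {M : Set V}
  (hM : IsCompact M) (hconvex : Convex ℝ M) {y₀ : Y} {z : F}
include hA hM hconvex

lemma eventually_mem_image (hz : z ∈ interior (A y₀ '' M)) : ∀ᶠ y in 𝓝 y₀, z ∈ A y '' M := by
  obtain ⟨δ, hδ, hball⟩ := Metric.nhds_basis_closedBall.mem_iff.1 (mem_interior_iff_mem_nhds.1 hz)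
  filter_upwards [eventually_image_subset_thickening hA hM hδ] with y ⟨_, hy⟩
  exact mem_of_closedBall_subset_thickening (hM.image (A y).continuous).isClosed
    (hconvex.linear_image (A y).toLinearMap) hδ.le (hball.trans hy)

lemma continuousAt_indicator_image (hz : z ∉ frontier (A y₀ '' M)) :
    ContinuousAt (fun y => (A y '' M).indicator (fun _ => (1 : ℝ)) z) y₀ := by
  by_cases hmem : z ∈ A y₀ '' M
  · have hint : z ∈ interior (A y₀ '' M) := by
      by_contra h
      exact hz ⟨subset_closure hmem, h⟩
    refine (continuousAt_const (y := (1 : ℝ))).congr ?_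
    filter_upwards [eventually_mem_image hA hM hconvex hint] with y hy
    rw [indicator_of_mem hy]
  · refine (continuousAt_const (y := (0 : ℝ))).congr ?_
    filter_upwards [eventually_notMem_image hA hM hmem] with y hy
    rw [indicator_of_notMem hy]

end Indicator

variable [FiniteDimensional ℝ F] [MeasurableSpace F] [BorelSpace F]

lemma continuous_volume_image [FirstCountableTopology Y] {A : Y → V →L[ℝ] F} (hA : Continuous A)
    {M : Set V} (hM : IsCompact M) (hconvex : Convex ℝ M) :
    Continuous fun y => volume.real (A y '' M) := by
  have hcompact (y) : IsCompact (A y '' M) := hM.image (A y).continuous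
  have hintegral (y) : volume.real (A y '' M) =
      ∫ z, (A y '' M).indicator (fun _ => (1 : ℝ)) z := by
    rw [integral_indicator_const _ (hcompact y).measurableSet, smul_eq_mul, mul_one]
  simp only [hintegral]
  refine continuous_iff_continuousAt.2 fun y₀ => ?_
  have hfrontier : ∀ᵐ z : F, z ∉ frontier (A y₀ '' M) := measure_eq_zero_iff_ae_notMem.1
    ((hconvex.linear_image (A y₀).toLinearMap).addHaar_frontier volume)
  refine continuousAt_of_dominated
    (bound := (Metric.thickening 1 (A y₀ '' M)).indicator fun _ => 1) ?_ ?_ ?_ ?_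
  · exact Eventually.of_forall fun y =>
      (stronglyMeasurable_const.indicator (hcompact y).measurableSet).aestronglyMeasurable
  · filter_upwards [eventually_image_subset_thickening hA hM one_pos] with y ⟨hy, _⟩
    refine Eventually.of_forall fun z => ?_
    rw [Real.norm_of_nonneg (indicator_nonneg (fun _ _ => zero_le_one) _)]
    exact indicator_le_indicator_of_subset hy (fun _ => zero_le_one) z
  · rw [integrable_indicator_iff Metric.isOpen_thickening.measurableSet]
    exact integrableOn_const (hcompact y₀).isBounded.thickening.measure_lt_top.ne
  · filter_upwards [hfrontier] with z hz using continuousAt_indicator_image hA hM hconvex hz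

lemma continuous_mixedVolume_mapBody [FirstCountableTopology Y] {A : Y → V →L[ℝ] F}
    (hA : Continuous A) {j : ℕ} (K : Fin j → ConvexBody V) :
    Continuous fun y => mixedVolume fun i => mapBody (A y) (K i) := by
  simp only [mixedVolume, ← map_sum, coe_mapBody]
  exact continuous_const.mul (continuous_finsetSum _ fun S _ =>
    continuous_const.mul (continuous_volume_image hA (ConvexBody.isCompact _)
      (ConvexBody.convex _)))

section Isometry

variable {F' : Type*} [NormedAddCommGroup F'] [InnerProductSpace ℝ F'] [FiniteDimensional ℝ F']
  [MeasurableSpace F'] [BorelSpace F'] (e : F ≃ₗᵢ[ℝ] F')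

lemma volume_real_image_isometry (S : Set F) : volume.real (e '' S) = volume.real S := by
  have h := e.measurePreserving.measure_preimage_emb e.toHomeomorph.measurableEmbedding (e '' S)
  rw [e.injective.preimage_image] at h
  rw [Measure.real, Measure.real, h]

lemma mixedVolume_mapBody_isometry {j : ℕ} (K : Fin j → ConvexBody F) :
    mixedVolume (fun i => mapBody (e.toContinuousLinearEquiv : F →L[ℝ] F') (K i)) =
      mixedVolume K := by
  simp only [mixedVolume, ← map_sum, coe_mapBody]
  congr! 3
  exact volume_real_image_isometry e _

end Isometry

end LinearImages

/-! ### Integration over the Grassmannian -/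

section Grassmannian

variable {n j : ℕ}

/-- The projection onto `ξ` after rotation by `g⁻¹`. Its images are congruent to projections onto
`g ξ`, but lie in a space that does not depend on `g`. -/
def rotProj (ξ : Gr n j) (g : O n) : E n →L[ℝ] ξ.space :=
  ξ.space.orthogonalProjectionOnto ∘L ((g⁻¹ : O n) : E n →L[ℝ] E n)

lemma continuous_rotProj (ξ : Gr n j) : Continuous (rotProj ξ) :=
  continuous_const.clm_comp (continuous_subtype_val.comp continuous_inv)

lemma linearIsometryEquiv_symm_apply (g : O n) (x : E n) :
    (Unitary.linearIsometryEquiv g).symm x = ((g⁻¹ : O n) : E n →L[ℝ] E n) x := rfl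

lemma starProjection_rotate (ξ : Gr n j) (g : O n) (x : E n) :
    (rotate g ξ).space.starProjection x = Unitary.linearIsometryEquiv g (rotProj ξ g x : E n) :=
  Submodule.starProjection_map_apply (Unitary.linearIsometryEquiv g) ξ.space x

lemma surjective_rotProj (ξ : Gr n j) (g : O n) : Function.Surjective (rotProj ξ g) := by
  intro y
  refine ⟨Unitary.linearIsometryEquiv g y, ?_⟩
  rw [rotProj, ContinuousLinearMap.comp_apply, ← linearIsometryEquiv_symm_apply,
    LinearIsometryEquiv.symm_apply_apply, Submodule.orthogonalProjectionOnto_mem_subspace_eq_self]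

/-- The isometry of `g ξ` onto `ξ` induced by `g⁻¹`. -/
def rotIsometry (ξ : Gr n j) (g : O n) : (rotate g ξ).space ≃ₗᵢ[ℝ] ξ.space :=
  (LinearIsometryEquiv.submoduleMap ξ.space (Unitary.linearIsometryEquiv g)).symm

lemma rotIsometry_orthogonalProjectionOnto (ξ : Gr n j) (g : O n) (x : E n) :
    rotIsometry ξ g ((rotate g ξ).space.orthogonalProjectionOnto x) = rotProj ξ g x := by
  rw [← (rotIsometry ξ g).eq_symm_apply]
  exact Subtype.ext (starProjection_rotate ξ g x)

lemma mapBody_rotIsometry (ξ : Gr n j) (g : O n) (K : ConvexBody (E n)) :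
    mapBody ((rotIsometry ξ g).toContinuousLinearEquiv : (rotate g ξ).space →L[ℝ] ξ.space)
      (proj K (rotate g ξ).space) = mapBody (rotProj ξ g) K := by
  refine ConvexBody.ext ?_
  rw [coe_mapBody, coe_mapBody]
  change _ '' ((rotate g ξ).space.orthogonalProjectionOnto '' (K : Set (E n))) = _
  rw [image_image]
  exact image_congr fun x _ => rotIsometry_orthogonalProjectionOnto ξ g x

lemma mixedVolume_proj_rotate {i : ℕ} (ξ : Gr n j) (g : O n) (K : Fin i → ConvexBody (E n)) :
    mixedVolume (fun a => proj (K a) (rotate g ξ).space) =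
      mixedVolume fun a => mapBody (rotProj ξ g) (K a) := by
  rw [← mixedVolume_mapBody_isometry (rotIsometry ξ g)]
  simp only [mapBody_rotIsometry]

lemma volume_proj_rotate (ξ : Gr n j) (g : O n) (K : ConvexBody (E n)) :
    volume.real (proj K (rotate g ξ).space : Set (rotate g ξ).space) =
      volume.real (mapBody (rotProj ξ g) K : Set ξ.space) := by
  rw [← volume_real_image_isometry (rotIsometry ξ g), ← mapBody_rotIsometry]
  rfl

lemma Gr.ext {ξ η : Gr n j} (h : ξ.space = η.space) : ξ = η := by
  cases ξ
  cases η
  congr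

lemma surjective_rotate (ξ : Gr n j) : Function.Surjective fun g : O n => rotate g ξ := by
  intro η
  let e : ξ.space ≃ₗᵢ[ℝ] η.space := (stdOrthonormalBasis ℝ ξ.space).equiv
    (stdOrthonormalBasis ℝ η.space) (finCongr (ξ.finrank_eq.trans η.finrank_eq.symm))
  let f : E n ≃ₗᵢ[ℝ] E n :=
    (η.space.subtypeₗᵢ.comp e.toLinearIsometry).extend.toLinearIsometryEquiv rfl
  have hf (x : ξ.space) : f x = e x := LinearIsometry.extend_apply _ x
  refine ⟨Unitary.linearIsometryEquiv.symm f, Gr.ext ?_⟩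
  change ξ.space.map _ = _
  rw [MulEquiv.apply_symm_apply]
  refine le_antisymm ?_ fun y hy => ?_
  · rintro _ ⟨x, hx, rfl⟩
    exact (hf ⟨x, hx⟩).symm ▸ (e ⟨x, hx⟩).2
  · refine ⟨e.symm ⟨y, hy⟩, (e.symm ⟨y, hy⟩).2, ?_⟩
    exact (hf _).trans (by rw [e.apply_symm_apply])

instance : T2Space (Gr n j) :=
  IsEmbedding.t2Space (f := fun ξ : Gr n j => ξ.space.starProjection)
    ⟨⟨rfl⟩, fun _ _ h => Gr.ext (Submodule.starProjection_inj.1 h)⟩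

lemma isQuotientMap_rotate (ξ : Gr n j) : IsQuotientMap fun g : O n => rotate g ξ :=
  (continuous_rotate ξ).isClosedMap.isQuotientMap (continuous_rotate ξ) (surjective_rotate ξ)

lemma integral_grMeasure (hj : j ≤ n) {f : Gr n j → ℝ}
    (hf : Continuous fun g : O n => f (rotate g (coordSubspace hj))) :
    ∫ ξ, f ξ ∂(grMeasure hj) = ∫ g, f (rotate g (coordSubspace hj)) ∂(haarO n) := by
  have hcont : Continuous f := (isQuotientMap_rotate (coordSubspace hj)).continuous_iff.2 hf
  exact integral_map (continuous_rotate _).measurable.aemeasurable hcont.aestronglyMeasurable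

end Grassmannian

/-! ### Hölder's inequality and its equality case -/

section Hoelder

lemma integral_mul_div_add_mul_div_eq_one {X : Type*} [MeasurableSpace X] {μ : Measure X}
    {P Q : X → ℝ} {p q : ℝ} (hpq : p + q = 1) (hP : Integrable P μ) (hQ : Integrable Q μ)
    (ha : 0 < ∫ x, P x ∂μ) (hb : 0 < ∫ x, Q x ∂μ) :
    ∫ x, p * (P x / ∫ x, P x ∂μ) + q * (Q x / ∫ x, Q x ∂μ) ∂μ = 1 := by
  rw [integral_add ((hP.div_const _).const_mul p) ((hQ.div_const _).const_mul q),
    integral_const_mul, integral_const_mul, integral_div, integral_div, div_self ha.ne',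
    div_self hb.ne', mul_one, mul_one, hpq]

variable {p q : ℝ} (hp : 0 < p) (hq : 0 < q) (hpq : p + q = 1)
include hp hq hpq

section Pointwise

variable {a b x y z : ℝ} (ha : 0 < a) (hb : 0 < b) (hx : 0 < x) (hy : 0 < y)
  (hz : z ≤ x ^ p * y ^ q)
include ha hb hx hy hz

lemma div_rpow_mul_rpow_le :
    z / (a ^ p * b ^ q) ≤ p * (x / a) + q * (y / b) :=
  calc z / (a ^ p * b ^ q) ≤ x ^ p * y ^ q / (a ^ p * b ^ q) := by gcongr
    _ = (x / a) ^ p * (y / b) ^ q := by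
      rw [Real.div_rpow hx.le ha.le, Real.div_rpow hy.le hb.le, div_mul_div_comm]
    _ ≤ p * (x / a) + q * (y / b) := Real.geom_mean_le_arith_mean2_weighted hp.le hq.le
      (by positivity) (by positivity) hpq

lemma eq_of_div_rpow_mul_rpow_eq (h : z / (a ^ p * b ^ q) = p * (x / a) + q * (y / b)) :
    z = x ^ p * y ^ q ∧ x / a = y / b := by
  have hle := div_rpow_mul_rpow_le hp hq hpq ha hb hx hy le_rfl
  have hz' : z / (a ^ p * b ^ q) = x ^ p * y ^ q / (a ^ p * b ^ q) :=
    le_antisymm (by gcongr) (h ▸ hle)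
  refine ⟨(div_left_inj' (by positivity)).1 hz', ?_⟩
  rw [← Real.geom_mean_eq_arith_mean2_weighted_iff_of_pos hp hq (by positivity) (by positivity) hpq,
    ← h, hz', Real.div_rpow hx.le ha.le, Real.div_rpow hy.le hb.le, div_mul_div_comm]

end Pointwise

variable {X : Type*} [MeasurableSpace X] {μ : Measure X} {P Q M : X → ℝ} (hP : Integrable P μ)
  (hQ : Integrable Q μ) (hM : Integrable M μ) (hP0 : ∀ x, 0 < P x) (hQ0 : ∀ x, 0 < Q x)
  (hle : ∀ x, M x ≤ P x ^ p * Q x ^ q) (ha : 0 < ∫ x, P x ∂μ) (hb : 0 < ∫ x, Q x ∂μ)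
include hP hQ hM hP0 hQ0 hle ha hb

lemma integral_le_rpow_mul_rpow :
    ∫ x, M x ∂μ ≤ (∫ x, P x ∂μ) ^ p * (∫ x, Q x ∂μ) ^ q := by
  rw [← div_le_one (by positivity), ← integral_div,
    ← integral_mul_div_add_mul_div_eq_one hpq hP hQ ha hb]
  exact integral_mono (hM.div_const _)
    (((hP.div_const _).const_mul p).add ((hQ.div_const _).const_mul q)) fun x =>
      div_rpow_mul_rpow_le hp hq hpq ha hb (hP0 x) (hQ0 x) (hle x)

lemma eq_of_rpow_mul_rpow_le_integral [TopologicalSpace X] [OpensMeasurableSpace X]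
    [μ.IsOpenPosMeasure] (hPc : Continuous P) (hQc : Continuous Q) (hMc : Continuous M)
    (h : (∫ x, P x ∂μ) ^ p * (∫ x, Q x ∂μ) ^ q ≤ ∫ x, M x ∂μ) (x : X) :
    M x = P x ^ p * Q x ^ q ∧ P x / ∫ x, P x ∂μ = Q x / ∫ x, Q x ∂μ := by
  set a := ∫ x, P x ∂μ
  set b := ∫ x, Q x ∂μ
  have hpointwise (x : X) : M x / (a ^ p * b ^ q) ≤ p * (P x / a) + q * (Q x / b) :=
    div_rpow_mul_rpow_le hp hq hpq ha hb (hP0 x) (hQ0 x) (hle x)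
  have heq : ∫ x, M x / (a ^ p * b ^ q) ∂μ = ∫ x, p * (P x / a) + q * (Q x / b) ∂μ := by
    rw [integral_div, integral_mul_div_add_mul_div_eq_one hpq hP hQ ha hb,
      div_eq_one_iff_eq (by positivity)]
    exact le_antisymm (integral_le_rpow_mul_rpow hp hq hpq hP hQ hM hP0 hQ0 hle ha hb) h
  have hae := (integral_eq_iff_of_ae_le (hM.div_const _)
    (((hP.div_const _).const_mul p).add ((hQ.div_const _).const_mul q))
    (Eventually.of_forall hpointwise)).1 heq
  exact eq_of_div_rpow_mul_rpow_eq hp hq hpq ha hb (hP0 x) (hQ0 x) (hle x)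
    (congrFun ((Continuous.ae_eq_iff_eq μ (by fun_prop) (by fun_prop)).1 hae) x)

end Hoelder

/-! ### Reconstruction of a homothety from projections -/

section Reconstruction

open scoped RealInnerProductSpace

section Linear

variable {V : Type*} [AddCommGroup V] [Module ℝ V]

lemma exists_le_finrank_eq [FiniteDimensional ℝ V] (W : Submodule ℝ V) {j : ℕ}
    (hW : Module.finrank ℝ W ≤ j) (hj : j ≤ Module.finrank ℝ V) :
    ∃ ξ : Submodule ℝ V, W ≤ ξ ∧ Module.finrank ℝ ξ = j := by
  induction j, hW using Nat.le_induction with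
  | base => exact ⟨W, le_rfl, rfl⟩
  | succ k _ ih =>
    obtain ⟨ξ, hξ, hk⟩ := ih (Nat.le_of_succ_le hj)
    obtain ⟨v, hv⟩ : ∃ v, v ∉ ξ := by
      by_contra! h
      rw [Submodule.eq_top_iff'.2 h, finrank_top] at hk
      lia
    exact ⟨ξ ⊔ Submodule.span ℝ {v}, hξ.trans le_sup_left, by
      rw [Submodule.finrank_sup_span_singleton hv, hk]⟩

lemma exists_linearMap_of_forall_pair {D : V → ℝ}
    (hD : ∀ a b, ∃ u : V →ₗ[ℝ] ℝ, ∀ x ∈ Submodule.span ℝ {a, b}, D x = u x) :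
    ∃ u : V →ₗ[ℝ] ℝ, ∀ x, D x = u x := by
  have hmem (a b : V) : a ∈ Submodule.span ℝ {a, b} ∧ b ∈ Submodule.span ℝ {a, b} :=
    ⟨Submodule.subset_span (mem_insert a _), Submodule.subset_span (mem_insert_of_mem a rfl)⟩
  refine ⟨{ toFun := D, map_add' := fun a b => ?_, map_smul' := fun r a => ?_ }, fun x => rfl⟩
  · obtain ⟨u, hu⟩ := hD a b
    obtain ⟨ha, hb⟩ := hmem a b
    rw [hu a ha, hu b hb, hu _ (add_mem ha hb), map_add]
  · obtain ⟨u, hu⟩ := hD a a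
    obtain ⟨ha, -⟩ := hmem a a
    rw [hu a ha, hu _ (Submodule.smul_mem _ r ha), map_smul, RingHom.id_apply]

end Linear

section SupportFunction

variable {V : Type*} [NormedAddCommGroup V] [NormedSpace ℝ V]

lemma suppFn_add_singleton {K : Set V} (hK : IsCompact K) (hne : K.Nonempty) (t : V)
    (u : V →L[ℝ] ℝ) : suppFn (K + {t}) u = suppFn K u + u t := by
  rw [suppFn, image_add, image_singleton, csSup_add (hne.image u)
    (hK.image u.continuous).bddAbove (singleton_nonempty _) bddAbove_singleton, csSup_singleton,
    suppFn]

lemma eq_smul_add_singleton_of_suppFn_eq {K L : ConvexBody V} {c : ℝ} (hc : 0 ≤ c) {t : V}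
    (h : ∀ u : V →L[ℝ] ℝ, suppFn (K : Set V) u = c * suppFn (L : Set V) u + u t) :
    (K : Set V) = c • (L : Set V) + {t} := by
  have hsupp (u : V →L[ℝ] ℝ) : suppFn (K : Set V) u = suppFn (c • (L : Set V) + {t}) u := by
    rw [suppFn_add_singleton (L.isCompact.smul c) L.nonempty.smul_set, suppFn_smul hc, h]
  have hcompact : IsCompact (c • (L : Set V) + {t}) :=
    (L.isCompact.smul c).add isCompact_singleton
  refine Subset.antisymm ?_ ?_
  · exact subset_of_suppFn_le K.isCompact hcompact ((L.convex.smul c).add (convex_singleton t))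
      (L.nonempty.smul_set.add (singleton_nonempty t)) fun u => (hsupp u).le
  · exact subset_of_suppFn_le hcompact K.isCompact K.convex K.nonempty fun u => (hsupp u).ge

end SupportFunction

variable {n j : ℕ}

lemma innerSL_eq_comp_rotProj (ξ : Gr n j) (g : O n) {a : E n} (ha : a ∈ (rotate g ξ).space) :
    innerSL ℝ a =
      (innerSL ℝ a ∘L (g : E n →L[ℝ] E n) ∘L ξ.space.subtypeL) ∘L rotProj ξ g := by
  ext1 x
  change ⟪a, x⟫ = ⟪a, Unitary.linearIsometryEquiv g (rotProj ξ g x : E n)⟫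
  rw [← starProjection_rotate, ← Submodule.inner_starProjection_left_eq_right,
    Submodule.starProjection_eq_self_iff.2 ha]

lemma finrank_span_pair_le {V : Type*} [AddCommGroup V] [Module ℝ V] (a b : V) :
    Module.finrank ℝ (Submodule.span ℝ {a, b}) ≤ 2 := by
  classical
  have h := finrank_span_finset_le_card (R := ℝ) ({a, b} : Finset V)
  rw [Finset.coe_pair] at h
  exact h.trans Finset.card_le_two

/-- Any two directions lie in a common `j`-dimensional subspace, so the difference of the support
functions of `K` and `c L` is linear on every plane, hence linear. -/
lemma homothetic_of_rotProj (hj2 : 2 ≤ j) (hjn : j ≤ n) (ξ : Gr n j) {K L : ConvexBody (E n)}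
    {c : ℝ} (hc : 0 < c)
    (h : ∀ g : O n, ∃ t : ξ.space, ∀ u : ξ.space →L[ℝ] ℝ,
      suppFn (rotProj ξ g '' (K : Set (E n))) u =
        c * suppFn (rotProj ξ g '' (L : Set (E n))) u + u t) :
    Homothetic K L := by
  let D (a : E n) : ℝ :=
    suppFn (K : Set (E n)) (innerSL ℝ a) - c * suppFn (L : Set (E n)) (innerSL ℝ a)
  have hplane (a b : E n) :
      ∃ u : E n →ₗ[ℝ] ℝ, ∀ x ∈ Submodule.span ℝ {a, b}, D x = u x := by
    obtain ⟨η, hspan, hη⟩ := exists_le_finrank_eq (Submodule.span ℝ {a, b})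
      ((finrank_span_pair_le a b).trans hj2) (finrank_euclideanSpace_fin (𝕜 := ℝ) ▸ hjn)
    obtain ⟨g, hg⟩ := surjective_rotate ξ ⟨η, hη⟩
    obtain ⟨t, ht⟩ := h g
    refine ⟨innerₗ (E n) ((g : E n →L[ℝ] E n) t), fun x hx => ?_⟩
    have hxg : x ∈ (rotate g ξ).space := (congrArg Gr.space hg).symm ▸ hspan hx
    have hx := ht (innerSL ℝ x ∘L (g : E n →L[ℝ] E n) ∘L ξ.space.subtypeL)
    rw [suppFn_image, suppFn_image, ← innerSL_eq_comp_rotProj ξ g hxg] at hx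
    exact (sub_eq_of_eq_add' hx).trans (real_inner_comm ((g : E n →L[ℝ] E n) t) x)
  obtain ⟨u, hu⟩ := exists_linearMap_of_forall_pair hplane
  let t := (InnerProductSpace.toDual ℝ (E n)).symm u.toContinuousLinearMap
  refine ⟨c, hc, t, eq_smul_add_singleton_of_suppFn_eq hc.le fun v => ?_⟩
  obtain ⟨a, rfl⟩ := (InnerProductSpace.toDual ℝ (E n)).surjective v
  have ha : u a = ⟪a, t⟫ := by
    rw [real_inner_comm, InnerProductSpace.toDual_symm_apply]
    rfl
  rw [← sub_eq_iff_eq_add']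
  exact (hu a).trans ha

end Reconstruction

/-! ### Means of negative order -/

section NegMean

/-- The power mean of order `-r` of a function `f` with respect to a measure `μ`. -/
def negMean {X : Type*} [MeasurableSpace X] (μ : Measure X) (r : ℝ) (f : X → ℝ) : ℝ :=
  (∫ x, f x ^ (-r) ∂μ) ^ (-1 / r)

lemma rpow_neg_rpow_neg_one_div {r : ℝ} (hr : r ≠ 0) {a : ℝ} (ha : 0 ≤ a) :
    (a ^ (-r)) ^ (-1 / r) = a := by
  rw [← Real.rpow_mul ha, show -r * (-1 / r) = 1 by field_simp, Real.rpow_one]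

lemma negMean_nonneg {X : Type*} [MeasurableSpace X] (μ : Measure X) (r : ℝ) {f : X → ℝ}
    (hf0 : ∀ x, 0 ≤ f x) : 0 ≤ negMean μ r f :=
  Real.rpow_nonneg (integral_nonneg fun x => Real.rpow_nonneg (hf0 x) _) _

lemma negMean_const_mul {X : Type*} [MeasurableSpace X] {μ : Measure X} {r : ℝ} (hr : r ≠ 0)
    {f : X → ℝ} (hf0 : ∀ x, 0 ≤ f x) {c : ℝ} (hc : 0 ≤ c) :
    negMean μ r (fun x => c * f x) = c * negMean μ r f := by
  simp only [negMean, Real.mul_rpow hc (hf0 _), integral_const_mul]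
  rw [Real.mul_rpow (Real.rpow_nonneg hc _)
    (integral_nonneg fun x => Real.rpow_nonneg (hf0 x) _), rpow_neg_rpow_neg_one_div hr hc]

lemma mul_rpow_rpow_comm {a b : ℝ} (ha : 0 ≤ a) (hb : 0 ≤ b) (p q s : ℝ) :
    (a ^ p * b ^ q) ^ s = (a ^ s) ^ p * (b ^ s) ^ q := by
  rw [Real.mul_rpow (by positivity) (by positivity), ← Real.rpow_mul ha, ← Real.rpow_mul hb,
    ← Real.rpow_mul ha, ← Real.rpow_mul hb, mul_comm p, mul_comm q]

lemma rpow_neg_le_of_rpow_mul_rpow_le {a b c p q r : ℝ} (ha : 0 < a) (hb : 0 < b) (hr : 0 ≤ r)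
    (h : a ^ p * b ^ q ≤ c) : c ^ (-r) ≤ (a ^ (-r)) ^ p * (b ^ (-r)) ^ q := by
  rw [← mul_rpow_rpow_comm ha.le hb.le]
  exact Real.rpow_le_rpow_of_nonpos (by positivity) h (neg_nonpos.2 hr)

variable {X : Type*} [TopologicalSpace X] [CompactSpace X] [MeasurableSpace X] [BorelSpace X]
  {μ : Measure X} [IsProbabilityMeasure μ]

lemma integrable_rpow {f : X → ℝ} (hf : Continuous f) (hf0 : ∀ x, 0 < f x) (s : ℝ) :
    Integrable (fun x => f x ^ s) μ :=
  (hf.rpow_const fun x => Or.inl (hf0 x).ne').integrable_of_hasCompactSupport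
    (HasCompactSupport.of_compactSpace _)

variable [μ.IsOpenPosMeasure]

lemma integral_rpow_pos {f : X → ℝ} (hf : Continuous f) (hf0 : ∀ x, 0 < f x) (s : ℝ) :
    0 < ∫ x, f x ^ s ∂μ := by
  obtain ⟨x⟩ : Nonempty X := nonempty_of_isProbabilityMeasure μ
  have hpos (x : X) : 0 < f x ^ s := Real.rpow_pos_of_pos (hf0 x) s
  exact (hf.rpow_const fun x => Or.inl (hf0 x).ne').integral_pos_of_hasCompactSupport_nonneg_nonzero
    (HasCompactSupport.of_compactSpace _) (fun x => (hpos x).le) (hpos x).ne'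

lemma negMean_rpow_mul_rpow {f g : X → ℝ} (hf : Continuous f) (hg : Continuous g)
    (hf0 : ∀ x, 0 < f x) (hg0 : ∀ x, 0 < g x) (p q r : ℝ) :
    negMean μ r f ^ p * negMean μ r g ^ q =
      ((∫ x, f x ^ (-r) ∂μ) ^ p * (∫ x, g x ^ (-r) ∂μ) ^ q) ^ (-1 / r) :=
  (mul_rpow_rpow_comm (integral_rpow_pos hf hf0 _).le (integral_rpow_pos hg hg0 _).le _ _ _).symm

variable {p q r : ℝ} (hp : 0 < p) (hq : 0 < q) (hpq : p + q = 1) (hr : 0 < r) {f g v : X → ℝ}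
  (hf : Continuous f) (hg : Continuous g) (hv : Continuous v) (hf0 : ∀ x, 0 < f x)
  (hg0 : ∀ x, 0 < g x) (hv0 : ∀ x, 0 < v x) (hle : ∀ x, f x ^ p * g x ^ q ≤ v x)
include hp hq hpq hr hf hg hv hf0 hg0 hv0 hle

theorem negMean_rpow_mul_rpow_le : negMean μ r f ^ p * negMean μ r g ^ q ≤ negMean μ r v := by
  have hF := integral_rpow_pos (μ := μ) hf hf0 (-r)
  have hG := integral_rpow_pos (μ := μ) hg hg0 (-r)
  rw [negMean_rpow_mul_rpow hf hg hf0 hg0, negMean, Real.rpow_le_rpow_iff_of_neg (by positivity)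
    (integral_rpow_pos hv hv0 _) (div_neg_of_neg_of_pos (by norm_num) hr)]
  exact integral_le_rpow_mul_rpow hp hq hpq (integrable_rpow hf hf0 _) (integrable_rpow hg hg0 _)
    (integrable_rpow hv hv0 _) (fun x => Real.rpow_pos_of_pos (hf0 x) _)
    (fun x => Real.rpow_pos_of_pos (hg0 x) _)
    (fun x => rpow_neg_le_of_rpow_mul_rpow_le (hf0 x) (hg0 x) hr.le (hle x)) hF hG

theorem eq_of_negMean_le_rpow_mul_rpow
    (h : negMean μ r v ≤ negMean μ r f ^ p * negMean μ r g ^ q) (x : X) :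
    v x = f x ^ p * g x ^ q ∧ f x / g x = negMean μ r f / negMean μ r g := by
  have hF := integral_rpow_pos (μ := μ) hf hf0 (-r)
  have hG := integral_rpow_pos (μ := μ) hg hg0 (-r)
  rw [negMean_rpow_mul_rpow hf hg hf0 hg0, negMean, Real.rpow_le_rpow_iff_of_neg
    (integral_rpow_pos hv hv0 _) (by positivity) (div_neg_of_neg_of_pos (by norm_num) hr)] at h
  have hcont {u : X → ℝ} (hu : Continuous u) (hu0 : ∀ x, 0 < u x) :
      Continuous fun x => u x ^ (-r) := hu.rpow_const fun x => Or.inl (hu0 x).ne'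
  obtain ⟨hvx, hratio⟩ := eq_of_rpow_mul_rpow_le_integral hp hq hpq (integrable_rpow hf hf0 _)
    (integrable_rpow hg hg0 _) (integrable_rpow hv hv0 _)
    (fun x => Real.rpow_pos_of_pos (hf0 x) _) (fun x => Real.rpow_pos_of_pos (hg0 x) _)
    (fun x => rpow_neg_le_of_rpow_mul_rpow_le (hf0 x) (hg0 x) hr.le (hle x)) hF hG
    (hcont hf hf0) (hcont hg hg0) (hcont hv hv0) h x
  have hf0x := hf0 x
  have hg0x := hg0 x
  constructor
  · rw [← mul_rpow_rpow_comm hf0x.le hg0x.le] at hvx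
    exact (Real.rpow_left_inj (hv0 x).le (by positivity) (neg_ne_zero.2 hr.ne')).1 hvx
  · rw [negMean, negMean, ← Real.div_rpow hF.le hG.le,
      ← (div_eq_div_iff_div_eq_div' hF.ne' (by positivity)).1 hratio,
      ← Real.div_rpow hf0x.le hg0x.le, rpow_neg_rpow_neg_one_div hr.ne' (by positivity)]

end NegMean

/-! ### Affine quermassintegrals -/

section Quermassintegral

lemma omega_pos (k : ℕ) : 0 < omega k :=
  (IsSolidBody.mk (isCompact_closedBall 0 1) (convex_closedBall 0 1)
    ⟨0, Metric.ball_subset_interior_closedBall (Metric.mem_ball_self one_pos)⟩).measureReal_pos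
    volume

instance (n : ℕ) : (haarO n).IsOpenPosMeasure := by
  unfold haarO
  infer_instance

lemma isSolidBody_mapBody_rotProj {n j : ℕ} (ξ : Gr n j) (g : O n) {K : ConvexBody (E n)}
    (hK : (interior (K : Set (E n))).Nonempty) :
    IsSolidBody (mapBody (rotProj ξ g) K : Set ξ.space) :=
  isSolidBody_coe ((hK.image _).mono
    (((rotProj ξ g).isOpenMap (surjective_rotProj ξ g)).image_interior_subset K))

/-- The volume of the projection of `K` onto the image of the coordinate subspace under `g`. -/
def projVolume {n j : ℕ} (hj : j ≤ n) (K : ConvexBody (E n)) (g : O n) : ℝ :=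
  volume.real (mapBody (rotProj (coordSubspace hj) g) K : Set (coordSubspace hj).space)

/-- The mixed volume with `j - 1` entries `K` and one entry `L` of the projections onto the image
of the coordinate subspace under `g`. -/
def projMixedVolume {n j : ℕ} (hj : j ≤ n) (K L : ConvexBody (E n)) (g : O n) : ℝ :=
  mixedVolumePair j (mapBody (rotProj (coordSubspace hj) g) K)
    (mapBody (rotProj (coordSubspace hj) g) L)

variable {n j : ℕ} (hj : j ≤ n)

lemma projVolume_pos {K : ConvexBody (E n)} (hK : (interior (K : Set (E n))).Nonempty)
    (g : O n) : 0 < projVolume hj K g :=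
  (isSolidBody_mapBody_rotProj _ g hK).measureReal_pos volume

lemma continuous_projVolume (K : ConvexBody (E n)) : Continuous (projVolume hj K) :=
  continuous_volume_image (continuous_rotProj _) K.isCompact K.convex

lemma mixedVolume_proj_pair (K L : ConvexBody (E n)) (g : O n) :
    mixedVolume (fun i : Fin j =>
      proj (if (i : ℕ) + 1 = j then L else K) (rotate g (coordSubspace hj)).space) =
      projMixedVolume hj K L g := by
  rw [mixedVolume_proj_rotate _ g fun i : Fin j => if (i : ℕ) + 1 = j then L else K]
  simp only [apply_ite (mapBody (rotProj _ g))]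
  rfl

lemma continuous_projMixedVolume (K L : ConvexBody (E n)) :
    Continuous (projMixedVolume hj K L) := by
  have h := continuous_mixedVolume_mapBody (continuous_rotProj (coordSubspace hj))
    fun i : Fin j => if (i : ℕ) + 1 = j then L else K
  simp only [apply_ite (mapBody (rotProj _ _))] at h
  exact h

lemma omega_mul_integral_grMeasure_rpow (hn : n ≠ 0) {f : Gr n j → ℝ} {F : O n → ℝ}
    (hF : Continuous F) (hF0 : ∀ g, 0 < F g)
    (hfF : ∀ g, f (rotate g (coordSubspace hj)) = F g) :
    omega n * (∫ ξ, (f ξ / omega j) ^ (-(n : ℝ)) ∂(grMeasure hj)) ^ (-1 / (n : ℝ)) =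
      omega n / omega j * negMean (haarO n) n F := by
  rw [integral_grMeasure hj]
  · simp only [hfF, div_eq_inv_mul (F _), div_eq_inv_mul (omega n)]
    rw [mul_assoc, mul_left_comm, ← negMean_const_mul (Nat.cast_ne_zero.2 hn)
      (fun g => (hF0 g).le) (inv_nonneg.2 (omega_pos j).le), negMean]
  · simp only [hfF]
    exact (hF.div_const _).rpow_const fun g => Or.inl (div_pos (hF0 g) (omega_pos j)).ne'

lemma Phi_eq_negMean (hn : n ≠ 0) {K : ConvexBody (E n)}
    (hK : (interior (K : Set (E n))).Nonempty) :
    Phi hj K = omega n / omega j * negMean (haarO n) n (projVolume hj K) :=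
  omega_mul_integral_grMeasure_rpow hj hn (continuous_projVolume hj K) (projVolume_pos hj hK)
    fun g => volume_proj_rotate _ g K

lemma Phi₁_eq_negMean (hn : n ≠ 0) {K L : ConvexBody (E n)}
    (hpos : ∀ g, 0 < projMixedVolume hj K L g) :
    Phi₁ hj K L = omega n / omega j * negMean (haarO n) n (projMixedVolume hj K L) :=
  omega_mul_integral_grMeasure_rpow hj hn (continuous_projMixedVolume hj K L) hpos
    (mixedVolume_proj_pair hj K L)

lemma Homothetic.symm {K L : ConvexBody (E n)} (h : Homothetic K L) : Homothetic L K := by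
  obtain ⟨c, hc, t, h⟩ := h
  refine ⟨c⁻¹, inv_pos.2 hc, -(c⁻¹ • t), ?_⟩
  rw [h, smul_add, smul_smul, inv_mul_cancel₀ hc.ne', one_smul, smul_set_singleton, add_assoc,
    singleton_add_singleton, add_neg_cancel, singleton_zero, add_zero]

section Homothety

variable {K L : ConvexBody (E n)} {c : ℝ} (hc : 0 < c) {t : E n}
  (hL : (L : Set (E n)) = c • (K : Set (E n)) + {t})
include hL

lemma mapBody_eq_smul_add_singleton {V : Type*} [NormedAddCommGroup V] [NormedSpace ℝ V]
    (A : E n →L[ℝ] V) : (mapBody A L : Set V) = c • (mapBody A K : Set V) + {A t} := by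
  rw [coe_mapBody, coe_mapBody, hL, image_add, image_smul_set, image_singleton]

include hc

lemma projVolume_of_homothetic (g : O n) : projVolume hj L g = c ^ j * projVolume hj K g := by
  rw [projVolume, mapBody_eq_smul_add_singleton hL, add_singleton, Measure.real, image_add_right,
    measure_preimage_add_right, ← Measure.real, measureReal_smul_of_nonneg volume hc.le,
    (coordSubspace hj).finrank_eq, projVolume]

lemma projMixedVolume_of_homothetic {m : ℕ} (hj : m + 1 ≤ n) (g : O n) :
    projMixedVolume hj K L g = c * projVolume hj K g :=
  mixedVolumePair_of_homothetic (coordSubspace hj).finrank_eq hc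
    (mapBody_eq_smul_add_singleton hL _)

end Homothety

lemma rpow_mul_rpow_pow_succ {a b : ℝ} (ha : 0 ≤ a) (hb : 0 ≤ b) (m : ℕ) :
    (a ^ (m / (m + 1) : ℝ) * b ^ (1 / (m + 1) : ℝ)) ^ (m + 1) = a ^ m * b := by
  rw [mul_pow, ← Real.rpow_natCast, ← Real.rpow_natCast, ← Real.rpow_mul ha, ← Real.rpow_mul hb,
    Nat.cast_succ, div_mul_cancel₀ _ (by positivity), div_mul_cancel₀ _ (by positivity),
    Real.rpow_natCast, Real.rpow_one]

lemma Phi_zero_eq (hn : n ≠ 0) {K L : ConvexBody (E n)}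
    (hK : (interior (K : Set (E n))).Nonempty) (hL : (interior (L : Set (E n))).Nonempty) :
    Phi n.zero_le K = Phi n.zero_le L := by
  have : Subsingleton (coordSubspace n.zero_le).space :=
    Module.finrank_zero_iff.1 (coordSubspace n.zero_le).finrank_eq
  have hvol (M : ConvexBody (E n)) : projVolume n.zero_le M = fun _ => volume.real univ :=
    funext fun g => congrArg volume.real
      (Subsingleton.eq_univ_of_nonempty (ConvexBody.nonempty _))
  rw [Phi_eq_negMean _ hn hK, Phi_eq_negMean _ hn hL, hvol, hvol]

lemma Phi₁_one (hj : 1 ≤ n) (K : ConvexBody (E n)) {L : ConvexBody (E n)}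
    (hL : (interior (L : Set (E n))).Nonempty) : Phi₁ hj K L = Phi hj L := by
  have hn : n ≠ 0 := Nat.one_le_iff_ne_zero.1 hj
  have hvol : projMixedVolume hj K L = projVolume hj L :=
    funext fun g => mixedVolumePair_one _ _ (coordSubspace hj).finrank_eq
  rw [Phi_eq_negMean hj hn hL, Phi₁_eq_negMean hj hn (hvol ▸ projVolume_pos hj hL), hvol]

section Inequality

variable {m : ℕ} (hj : m + 1 ≤ n) {K L : ConvexBody (E n)}
  (hK : (interior (K : Set (E n))).Nonempty) (hL : (interior (L : Set (E n))).Nonempty)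
include hK hL

lemma rpow_mul_rpow_le_projMixedVolume (g : O n) :
    projVolume hj K g ^ (m / (m + 1) : ℝ) * projVolume hj L g ^ (1 / (m + 1) : ℝ) ≤
      projMixedVolume hj K L g :=
  rpow_mul_rpow_le_mixedVolumePair (coordSubspace hj).finrank_eq
    (isSolidBody_mapBody_rotProj _ g hK) (isSolidBody_mapBody_rotProj _ g hL)

lemma projMixedVolume_pos (g : O n) : 0 < projMixedVolume hj K L g :=
  (mul_pos (Real.rpow_pos_of_pos (projVolume_pos hj hK g) _)
    (Real.rpow_pos_of_pos (projVolume_pos hj hL g) _)).trans_le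
      (rpow_mul_rpow_le_projMixedVolume hj hK hL g)

theorem Phi₁_pow_eq_of_homothetic (h : Homothetic K L) :
    Phi₁ hj K L ^ (m + 1) = Phi hj K ^ m * Phi hj L := by
  have hn : n ≠ 0 := by lia
  obtain ⟨c, hc, t, hLK⟩ := h.symm
  have hmean {d : ℝ} (hd : 0 ≤ d) : negMean (haarO n) n (fun g => d * projVolume hj K g) =
      d * negMean (haarO n) n (projVolume hj K) :=
    negMean_const_mul (Nat.cast_ne_zero.2 hn) (fun g => (projVolume_pos hj hK g).le) hd
  rw [Phi_eq_negMean hj hn hK, Phi_eq_negMean hj hn hL,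
    Phi₁_eq_negMean hj hn (projMixedVolume_pos hj hK hL),
    funext (projVolume_of_homothetic hj hc hLK), funext (projMixedVolume_of_homothetic hc hLK hj),
    hmean hc.le, hmean (by positivity)]
  ring

lemma Phi_pow_mul_Phi_eq (hn : n ≠ 0) :
    Phi hj K ^ m * Phi hj L = (omega n / omega (m + 1) *
      (negMean (haarO n) n (projVolume hj K) ^ (m / (m + 1) : ℝ) *
        negMean (haarO n) n (projVolume hj L) ^ (1 / (m + 1) : ℝ))) ^ (m + 1) := by
  rw [mul_pow, rpow_mul_rpow_pow_succ
    (negMean_nonneg _ _ fun g => (projVolume_pos hj hK g).le)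
    (negMean_nonneg _ _ fun g => (projVolume_pos hj hL g).le),
    Phi_eq_negMean hj hn hK, Phi_eq_negMean hj hn hL]
  ring

variable (hm : m ≠ 0)
include hm

theorem Phi_pow_mul_Phi_le : Phi hj K ^ m * Phi hj L ≤ Phi₁ hj K L ^ (m + 1) := by
  have hn : n ≠ 0 := by lia
  have hωn := omega_pos n
  have hωm := omega_pos (m + 1)
  have hA := negMean_nonneg (haarO n) n fun g => (projVolume_pos hj hK g).le
  have hB := negMean_nonneg (haarO n) n fun g => (projVolume_pos hj hL g).le
  rw [Phi_pow_mul_Phi_eq hj hK hL hn, Phi₁_eq_negMean hj hn (projMixedVolume_pos hj hK hL)]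
  gcongr
  exact negMean_rpow_mul_rpow_le (by positivity) (by positivity) (by field_simp)
    (by positivity) (continuous_projVolume hj K) (continuous_projVolume hj L)
    (continuous_projMixedVolume hj K L) (projVolume_pos hj hK) (projVolume_pos hj hL)
    (projMixedVolume_pos hj hK hL) (rpow_mul_rpow_le_projMixedVolume hj hK hL)

theorem homothetic_of_Phi₁_pow_le (h : Phi₁ hj K L ^ (m + 1) ≤ Phi hj K ^ m * Phi hj L) :
    Homothetic K L := by
  have hn : n ≠ 0 := by lia
  have hκ : 0 < omega n / omega (m + 1) := div_pos (omega_pos n) (omega_pos (m + 1))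
  have hA := negMean_nonneg (haarO n) n fun g => (projVolume_pos hj hK g).le
  have hB := negMean_nonneg (haarO n) n fun g => (projVolume_pos hj hL g).le
  have hV := negMean_nonneg (haarO n) n fun g => (projMixedVolume_pos hj hK hL g).le
  rw [Phi_pow_mul_Phi_eq hj hK hL hn, Phi₁_eq_negMean hj hn (projMixedVolume_pos hj hK hL),
    pow_le_pow_iff_left₀ (by positivity) (by positivity) m.succ_ne_zero,
    mul_le_mul_iff_right₀ hκ] at h
  have heq := eq_of_negMean_le_rpow_mul_rpow (by positivity) (by positivity) (by field_simp)
    (by positivity) (continuous_projVolume hj K) (continuous_projVolume hj L)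
    (continuous_projMixedVolume hj K L) (projVolume_pos hj hK) (projVolume_pos hj hL)
    (projMixedVolume_pos hj hK hL) (rpow_mul_rpow_le_projMixedVolume hj hK hL) h
  have hratio : 0 < negMean (haarO n) n (projVolume hj K) / negMean (haarO n) n (projVolume hj L) :=
    (heq 1).2 ▸ div_pos (projVolume_pos hj hK 1) (projVolume_pos hj hL 1)
  refine homothetic_of_rotProj (by lia) hj (coordSubspace hj)
    (Real.rpow_pos_of_pos hratio (1 / (m + 1))) fun g => ?_
  rw [← (heq g).2]
  exact exists_suppFn_eq_of_mixedVolumePair_le (coordSubspace hj).finrank_eq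
    (isSolidBody_mapBody_rotProj _ g hK) (isSolidBody_mapBody_rotProj _ g hL) (heq g).1.le

end Inequality

end Quermassintegral

end MixedAffine

end

theorem theorem2p1_general (n j : ℕ) (hn : 1 ≤ n) (hj : j ≤ n)
    (K L : ConvexBody (EuclideanSpace ℝ (Fin n)))
    (hK : (interior (K : Set (EuclideanSpace ℝ (Fin n)))).Nonempty)
    (hL : (interior (L : Set (EuclideanSpace ℝ (Fin n)))).Nonempty) :
    MixedAffine.Phi hj K ^ ((j : ℤ) - 1) * MixedAffine.Phi hj L ≤ MixedAffine.Phi₁ hj K L ^ j ∧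
    (2 ≤ j →
      (MixedAffine.Phi₁ hj K L ^ j = MixedAffine.Phi hj K ^ ((j : ℤ) - 1) * MixedAffine.Phi hj L ↔
        MixedAffine.Homothetic K L)) := by
  match j, hj with
  | 0, _ =>
    rw [MixedAffine.Phi_zero_eq (Nat.one_le_iff_ne_zero.1 hn) hK hL]
    exact ⟨by simpa using inv_mul_le_one, by lia⟩
  | 1, hj =>
    rw [MixedAffine.Phi₁_one hj K hL]
    exact ⟨by simp, by lia⟩
  | m + 2, hj =>
    have hm : m + 1 ≠ 0 := m.succ_ne_zero
    rw [show ((m + 2 : ℕ) : ℤ) - 1 = (m + 1 : ℕ) by lia, zpow_natCast]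
    exact ⟨MixedAffine.Phi_pow_mul_Phi_le hj hK hL hm, fun _ =>
      ⟨fun h => MixedAffine.homothetic_of_Phi₁_pow_le hj hK hL hm h.le,
        MixedAffine.Phi₁_pow_eq_of_homothetic hj hK hL⟩⟩

theorem theorem2p1 (n j : ℕ) (hn : 1 ≤ n) (hj : j ≤ n)
    (K L : ConvexBody (EuclideanSpace ℝ (Fin n)))
    (hK : (interior (K : Set (EuclideanSpace ℝ (Fin n)))).Nonempty) (hK0 : 0 ∈ K)
    (hL : (interior (L : Set (EuclideanSpace ℝ (Fin n)))).Nonempty) (hL0 : 0 ∈ L) :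
    MixedAffine.Phi hj K ^ ((j : ℤ) - 1) * MixedAffine.Phi hj L ≤ MixedAffine.Phi₁ hj K L ^ j ∧
    (2 ≤ j →
      (MixedAffine.Phi₁ hj K L ^ j = MixedAffine.Phi hj K ^ ((j : ℤ) - 1) * MixedAffine.Phi hj L ↔
        MixedAffine.Homothetic K L)) :=
  theorem2p1_general n j hn hj K L hK hL
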